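/- Let $(\bar M,\bar J,\bar g)$ be an almost Hermitian manifold (a smooth Riemannian manifold with a smooth $(1,1)$-tensor $\bar J$ such that $\bar J^2=-\mathrm{id}$ and $\bar g(\bar JX,\bar JY)=\bar g(X,Y)$) whose sectional curvature is at most $c\in\mathbb{R}$. Let $M^{d+l}$ ($d,l>0$) be a CR-submanifold of $\bar M$, i.e. an immersed submanifold, with induced metric $g$, such that $D=\bar J(TM)\cap TM$ has constant real dimension $d$. Let $R$ be the curvature tensor of $(M,g)$ and $h$ the second fundamental form of $M$. For a subspace $V\subset T_xM$ with orthonormal basis $\{e_a\}$ put $$\tau(V)=\sum_{a,b} g(R_{e_a,e_b}e_b,e_a),\qquad H_V=\sum_a h(e_a,e_a),$$ and write $\tau_D(x)=\tau(D_x)$, $H_D(x)=H_{D_x}$. For $k\ge 0$ and nonnegative integers $n_1,\dots,n_k$ with $\sum_i n_i\le d$ put $$2\,\delta_D(n_1,\dots,n_k)(x)=\tau_D(x)-\min\{\tau(V_1)+\dots+\tau(V_k)\},$$ where $V_1,\dots,V_k$ run over all mutually orthogonal subspaces of $D_x$ with $\dim V_i=n_i$. **Theorem (Chen-type inequality).**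 At every point of $M$, for every $k$-tuple $(n_1,\dots,n_k)$ with $\sum_i n_i\le d$, $$\delta_D(n_1,\dots,n_k)\le \frac{d^2\,(d+k-1-\sum_i n_i)}{2\,(d+k-\sum_i n_i)}\,\|H_D\|^2+\frac c2\Big[d(d-1)-\sum_i n_i(n_i-1)\Big].$$ The same inequality also holds with $H_D$ replaced by the averaged mean curvature vector $\frac1d H_D=\frac1d\sum_a h(e_a,e_a)$, where $\{e_a\}$ is an orthonormal basis of $D_x$. -/

import Mathlib

open scoped Manifold ContDiff

noncomputable section

namespace CRGeom

/-! ### Linear algebra in one tangent space with scalar product `g` -/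

section LinearAlgebra

variable {T : Type*} [AddCommGroup T] [Module ℝ T] [TopologicalSpace T]
variable {W : Type*} [AddCommGroup W] [Module ℝ W]

/-- `e` is a `g`-orthonormal basis of the subspace `V`. -/
def IsFrame (g : T →L[ℝ] T →L[ℝ] ℝ) (V : Submodule ℝ T) {n : ℕ} (e : Fin n → T) : Prop :=
  (∀ i j, g (e i) (e j) = if i = j then 1 else 0) ∧ Submodule.span ℝ (Set.range e) = V

open Classical in
/-- A `g`-orthonormal basis of `V`; it exists if `g` is a scalar product (`exists_isFrame`). -/
def frame (g : T →L[ℝ] T →L[ℝ] ℝ) (V : Submodule ℝ T) : Fin (Module.finrank ℝ V) → T :=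
  if h : ∃ e : Fin (Module.finrank ℝ V) → T, IsFrame g V e then h.choose else 0

/-- The trace over `V` with respect to `g` of a bilinear map `B`: the sum `∑ B(eᵢ, eᵢ)` over
a `g`-orthonormal basis of `V`. It does not depend on that basis (`traceOn_eq_sum`). -/
def traceOn (g : T →L[ℝ] T →L[ℝ] ℝ) (V : Submodule ℝ T) (B : T → T → W) : W :=
  ∑ i, B (frame g V i) (frame g V i)

theorem exists_isFrame (g : T →L[ℝ] T →L[ℝ] ℝ) (hs : ∀ u v, g u v = g v u)
    (hp : ∀ u, u ≠ 0 → 0 < g u u) (V : Submodule ℝ T) [FiniteDimensional ℝ V] :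
    ∃ e : Fin (Module.finrank ℝ V) → T, IsFrame g V e := by
  let B : LinearMap.BilinForm ℝ V :=
    LinearMap.mk₂ ℝ (fun u v : V => g u v) (by simp) (by simp) (by simp) (by simp)
  have hB : LinearMap.IsSymm B := ⟨fun u v => hs u v⟩
  obtain ⟨b, hb⟩ := LinearMap.BilinForm.exists_orthogonal_basis (B := B) hB
  have hpos : ∀ i, 0 < g (b i : T) (b i) := fun i =>
    hp _ (by simpa using b.ne_zero i)
  have hne : ∀ i, Real.sqrt (g (b i : T) (b i)) ≠ 0 := fun i => (Real.sqrt_pos.2 (hpos i)).ne'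
  refine ⟨fun i => (Real.sqrt (g (b i : T) (b i)))⁻¹ • (b i : T), ?_, ?_⟩
  · intro i j
    by_cases h : i = j
    · subst h
      simp only [map_smul, _root_.smul_apply, smul_eq_mul, if_true]
      have := Real.mul_self_sqrt (hpos i).le
      have h0 := hne i
      field_simp
      rw [sq, this]
    · have : g (b i : T) (b j) = 0 := hb h
      simp [h, this]
  · apply le_antisymm
    · rw [Submodule.span_le]
      rintro _ ⟨i, rfl⟩
      exact V.smul_mem _ (b i).2
    · intro v hv
      have h1 : v = ∑ i, b.repr ⟨v, hv⟩ i • (b i : T) := by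
        have := congrArg V.subtype (b.sum_repr ⟨v, hv⟩)
        rw [map_sum] at this
        exact this.symm
      rw [h1]
      refine Submodule.sum_mem _ fun i _ => ?_
      have h2 : (b i : T) = Real.sqrt (g (b i : T) (b i)) •
          ((Real.sqrt (g (b i : T) (b i)))⁻¹ • (b i : T)) := by
        rw [smul_smul, mul_inv_cancel₀ (hne i), one_smul]
      rw [h2]
      exact Submodule.smul_mem _ _ (Submodule.smul_mem _ _ (Submodule.subset_span ⟨i, rfl⟩))

theorem IsFrame.eq_sum {g : T →L[ℝ] T →L[ℝ] ℝ} {V : Submodule ℝ T} {n : ℕ} {e : Fin n → T}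
    (he : IsFrame g V e) {v : T} (hv : v ∈ V) : v = ∑ i, g (e i) v • e i := by
  rw [← he.2, Submodule.mem_span_range_iff_exists_fun] at hv
  obtain ⟨c, rfl⟩ := hv
  refine Finset.sum_congr rfl fun i _ => ?_
  simp [map_sum, he.1]

theorem traceOn_eq_sum (g : T →L[ℝ] T →L[ℝ] ℝ) (hs : ∀ u v, g u v = g v u)
    (hp : ∀ u, u ≠ 0 → 0 < g u u) (V : Submodule ℝ T) [FiniteDimensional ℝ V]
    (B : T →ₗ[ℝ] T →ₗ[ℝ] W) {n : ℕ} {e : Fin n → T} (he : IsFrame g V e) :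
    traceOn g V (fun u v => B u v) = ∑ i, B (e i) (e i) := by
  have hf : IsFrame g V (frame g V) := by
    have h := exists_isFrame g hs hp V
    rw [frame, dif_pos h]
    exact h.choose_spec
  have hmem : ∀ i, frame g V i ∈ V := fun i => by
    have := Submodule.subset_span (R := ℝ) (Set.mem_range_self (f := frame g V) i)
    rwa [hf.2] at this
  have hmem' : ∀ i, e i ∈ V := fun i => by
    have := Submodule.subset_span (R := ℝ) (Set.mem_range_self (f := e) i)
    rwa [he.2] at this
  have key : ∀ j k, ∑ i, g (e j) (frame g V i) * g (e k) (frame g V i)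
      = if j = k then 1 else 0 := by
    intro j k
    rw [← he.1 j k]
    conv_rhs => rw [hf.eq_sum (hmem' k)]
    simp only [map_sum, map_smul, smul_eq_mul]
    exact Finset.sum_congr rfl fun i _ => by rw [hs (e k), mul_comm]
  calc traceOn g V (fun u v => B u v)
      = ∑ i, B (∑ j, g (e j) (frame g V i) • e j) (∑ k, g (e k) (frame g V i) • e k) :=
        Finset.sum_congr rfl fun i _ => by rw [← he.eq_sum (hmem i)]
    _ = ∑ i, ∑ j, ∑ k, (g (e j) (frame g V i) * g (e k) (frame g V i)) • B (e j) (e k) := by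
        simp only [map_sum, map_smul, LinearMap.sum_apply, LinearMap.smul_apply, Finset.smul_sum,
          smul_smul]
        refine Finset.sum_congr rfl fun i _ => ?_
        rw [Finset.sum_comm]
        simp only [mul_comm]
    _ = ∑ j, ∑ k, (∑ i, g (e j) (frame g V i) * g (e k) (frame g V i)) • B (e j) (e k) := by
        rw [Finset.sum_comm]
        refine Finset.sum_congr rfl fun j _ => ?_
        rw [Finset.sum_comm]
        exact Finset.sum_congr rfl fun k _ => by rw [Finset.sum_smul]
    _ = ∑ i, B (e i) (e i) := by simp [key]

/-- The scalar curvature of the subspace `V` for a curvature tensor `R` and the scalar product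
`g`: the `g`-trace over `V` of the Ricci form `Ric_V(u, v) = tr_V (z ↦ R_{z,u} v)` of `V`, that is
`τ(V) = ∑_{a,b} g(R(e_a, e_b) e_b, e_a)` over an orthonormal basis of `V`. -/
def scalarCurv (g : T →L[ℝ] T →L[ℝ] ℝ) (R : T → T → T → T) (V : Submodule ℝ T) : ℝ :=
  traceOn g V fun u v => traceOn g V fun z z' => g (R z u v) z'

/-- `V₁, …, V_k` are mutually `g`-orthogonal subspaces of `D` with `dim V_i = n_i`. -/
def IsOrthogonalTuple (g : T →L[ℝ] T →L[ℝ] ℝ) (D : Submodule ℝ T) {k : ℕ} (n : Fin k → ℕ)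
    (V : Fin k → Submodule ℝ T) : Prop :=
  (∀ i, V i ≤ D) ∧ (∀ i, Module.finrank ℝ (V i) = n i) ∧
    ∀ i j, i ≠ j → ∀ u ∈ V i, ∀ v ∈ V j, g u v = 0

/-- Chen-type invariant of the subspace `D`:
`2 δ_D(n₁, …, n_k) = τ(D) - min (τ(V₁) + ⋯ + τ(V_k))` over all mutually orthogonal subspaces
`V_i` of `D` with `dim V_i = n_i`. (The infimum below is a minimum by compactness when
`n₁ + ⋯ + n_k ≤ dim D`.) -/
def chenDelta (g : T →L[ℝ] T →L[ℝ] ℝ) (R : T → T → T → T) (D : Submodule ℝ T) {k : ℕ}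
    (n : Fin k → ℕ) : ℝ :=
  (scalarCurv g R D -
    sInf {t : ℝ | ∃ V, IsOrthogonalTuple g D n V ∧ t = ∑ i, scalarCurv g R (V i)}) / 2

end LinearAlgebra

/-! ### Local Riemannian geometry in coordinates -/

section Coordinates

variable {E : Type*} [NormedAddCommGroup E] [NormedSpace ℝ E]

/-- Christoffel symbols of the Levi-Civita connection of the metric `G` on an open set of `E`:
`Γ_p(u, v)` is the vector with `G_p(Γ_p(u, v), w) =
½ (∂_u G(v, w) + ∂_v G(u, w) - ∂_w G(u, v))` for all `w`. In terms of it, the connection is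
`∇_X Y = ∂_X Y + Γ(X, Y)`. -/
def christoffel (G : E → E →L[ℝ] E →L[ℝ] ℝ) (p u v : E) : E :=
  (G p).inverse ((1 / 2 : ℝ) •
    (fderiv ℝ G p u v + fderiv ℝ G p v u - ((fderiv ℝ G p).flip u).flip v))

/-- The curvature tensor `R_{u,v} w = ∇_u ∇_v w - ∇_v ∇_u w` (for constant fields `u, v, w`)
of the metric `G` on an open set of `E`. -/
def coordCurvature (G : E → E →L[ℝ] E →L[ℝ] ℝ) (p u v w : E) : E :=
  fderiv ℝ (fun q => christoffel G q v w) p u - fderiv ℝ (fun q => christoffel G q u w) p v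
    + christoffel G p u (christoffel G p v w) - christoffel G p v (christoffel G p u w)

end Coordinates

/-! ### Manifolds -/

section Manifold

variable {E : Type*} [NormedAddCommGroup E] [NormedSpace ℝ E]
  {M : Type*} [TopologicalSpace M] [ChartedSpace E M]
variable {E' : Type*} [NormedAddCommGroup E'] [NormedSpace ℝ E']
  {N : Type*} [TopologicalSpace N] [ChartedSpace E' N]

/-- The metric `g` in the preferred chart at `x`, as a function on the target of the chart. -/
def chartMetric (g : ∀ y : M, TangentSpace 𝓘(ℝ, E) y →L[ℝ] TangentSpace 𝓘(ℝ, E) y →L[ℝ] ℝ)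
    (x : M) (p : E) : E →L[ℝ] E →L[ℝ] ℝ :=
  ContinuousLinearMap.bilinearComp (E := E) (F := E) (E' := E) (F' := E)
    (g ((extChartAt 𝓘(ℝ, E) x).symm p))
    (mfderiv 𝓘(ℝ, E) 𝓘(ℝ, E) (extChartAt 𝓘(ℝ, E) x).symm p)
    (mfderiv 𝓘(ℝ, E) 𝓘(ℝ, E) (extChartAt 𝓘(ℝ, E) x).symm p)

/-- The curvature tensor `R_{u,v} w` at `x` of the Riemannian metric `g`, computed in the preferred
chart at `x`. By definition `TangentSpace 𝓘(ℝ, E) x` is the model space `E`, the identification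
being the derivative at `x` of this very chart. -/
def curvature (g : ∀ y : M, TangentSpace 𝓘(ℝ, E) y →L[ℝ] TangentSpace 𝓘(ℝ, E) y →L[ℝ] ℝ)
    (x : M) (u v w : TangentSpace 𝓘(ℝ, E) x) : TangentSpace 𝓘(ℝ, E) x :=
  coordCurvature (E := E) (chartMetric g x) (extChartAt 𝓘(ℝ, E) x x) u v w

/-- The sectional curvature of the plane spanned by linearly independent `u, v`. -/
def sectionalCurvature
    (g : ∀ y : M, TangentSpace 𝓘(ℝ, E) y →L[ℝ] TangentSpace 𝓘(ℝ, E) y →L[ℝ] ℝ)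
    (x : M) (u v : TangentSpace 𝓘(ℝ, E) x) : ℝ :=
  g x (curvature g x u v v) u / (g x u u * g x v v - g x u v ^ 2)

/-- All sectional curvatures are at most `c`. -/
def SectionalCurvatureLE
    (g : ∀ y : M, TangentSpace 𝓘(ℝ, E) y →L[ℝ] TangentSpace 𝓘(ℝ, E) y →L[ℝ] ℝ) (c : ℝ) : Prop :=
  ∀ (x : M) (u v : TangentSpace 𝓘(ℝ, E) x), LinearIndependent ℝ ![u, v] →
    sectionalCurvature g x u v ≤ c

/-- The metric on `M` induced by `f : M → N` from the metric `g` on `N`. -/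
def inducedMetric
    (g : ∀ y : N, TangentSpace 𝓘(ℝ, E') y →L[ℝ] TangentSpace 𝓘(ℝ, E') y →L[ℝ] ℝ)
    (f : M → N) (x : M) : TangentSpace 𝓘(ℝ, E) x →L[ℝ] TangentSpace 𝓘(ℝ, E) x →L[ℝ] ℝ :=
  ContinuousLinearMap.bilinearComp (E := E') (F := E') (E' := E) (F' := E) (g (f x))
    (mfderiv 𝓘(ℝ, E) 𝓘(ℝ, E') f x) (mfderiv 𝓘(ℝ, E) 𝓘(ℝ, E') f x)

/-- The second fundamental form `h(X, Y) = ∇̄_X Y - ∇_X Y` of `f : M → N` at `x`. If `F` is `f`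
in the preferred charts at `x` and `f x`, and `u, v` are constant fields in the chart at `x`, then
`∇̄_u (dF v) = D²F(u, v) + Γ̄(dF u, dF v)` and `∇_u v = Γ(u, v)`, with the Levi-Civita connections
of the metric `g` of `N` and of the induced metric of `M`. -/
def secondFundamentalForm
    (g : ∀ y : N, TangentSpace 𝓘(ℝ, E') y →L[ℝ] TangentSpace 𝓘(ℝ, E') y →L[ℝ] ℝ)
    (f : M → N) (x : M) (u v : TangentSpace 𝓘(ℝ, E) x) : TangentSpace 𝓘(ℝ, E') (f x) :=
  let F : E → E' := writtenInExtChartAt 𝓘(ℝ, E) 𝓘(ℝ, E') x f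
  let p : E := extChartAt 𝓘(ℝ, E) x x
  fderiv ℝ (fderiv ℝ F) p u v
    + christoffel (E := E') (chartMetric g (f x)) (F p) (fderiv ℝ F p u) (fderiv ℝ F p v)
    - fderiv ℝ F p (christoffel (E := E) (chartMetric (inducedMetric g f) x) p u v)

/-- The mean curvature vector `H_V = ∑ h(e_i, e_i)` of a subspace `V` of `T_x M`, where `e_i`
is an orthonormal basis of `V`. -/
def meanCurvature
    (g : ∀ y : N, TangentSpace 𝓘(ℝ, E') y →L[ℝ] TangentSpace 𝓘(ℝ, E') y →L[ℝ] ℝ)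
    (f : M → N) (x : M) (V : Submodule ℝ (TangentSpace 𝓘(ℝ, E) x)) :
    TangentSpace 𝓘(ℝ, E') (f x) :=
  traceOn (inducedMetric g f x) V (secondFundamentalForm g f x)

variable (E' N) in
/-- An almost Hermitian structure: a smooth Riemannian metric `g` and a smooth `(1,1)`-tensor `J`
with `J² = -1` and `g(JX, JY) = g(X, Y)` (hence `J` is skew-symmetric). -/
structure AlmostHermitian [IsManifold 𝓘(ℝ, E') ∞ N] where
  metric : Bundle.ContMDiffRiemannianMetric 𝓘(ℝ, E') ∞ E' (fun y : N => TangentSpace 𝓘(ℝ, E') y)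
  J (y : N) : TangentSpace 𝓘(ℝ, E') y →L[ℝ] TangentSpace 𝓘(ℝ, E') y
  J_sq (y : N) (u : TangentSpace 𝓘(ℝ, E') y) : J y (J y u) = -u
  J_isometry (y : N) (u v : TangentSpace 𝓘(ℝ, E') y) :
    metric.inner y (J y u) (J y v) = metric.inner y u v
  contMDiff_J : ContMDiff 𝓘(ℝ, E') (𝓘(ℝ, E').prod 𝓘(ℝ, E' →L[ℝ] E')) ∞
    (fun y => Bundle.TotalSpace.mk' (E' →L[ℝ] E')
      (E := fun y : N => TangentSpace 𝓘(ℝ, E') y →L[ℝ] TangentSpace 𝓘(ℝ, E') y) y (J y))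

variable [IsManifold 𝓘(ℝ, E') ∞ N]

/-- The distribution `D = J(TM) ∩ TM` of an immersed submanifold `f : M → N`, as a subspace of
`T_x M`. -/
def complexDistribution (S : AlmostHermitian E' N) (f : M → N) (x : M) :
    Submodule ℝ (TangentSpace 𝓘(ℝ, E) x) :=
  ((LinearMap.range (mfderiv 𝓘(ℝ, E) 𝓘(ℝ, E') f x).toLinearMap).map
    (S.J (f x)).toLinearMap).comap (mfderiv 𝓘(ℝ, E) 𝓘(ℝ, E') f x).toLinearMap

/-- `f : M → N` is an (immersed) CR-submanifold of dimension `d + l`, with `d, l > 0`, of the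
almost Hermitian manifold `N`: the distribution `D = J(TM) ∩ TM` has constant dimension `d`. -/
structure IsCRSubmanifold (S : AlmostHermitian E' N) (f : M → N) (d l : ℕ) : Prop where
  contMDiff : ContMDiff 𝓘(ℝ, E) 𝓘(ℝ, E') ∞ f
  immersion : ∀ x, Function.Injective (mfderiv 𝓘(ℝ, E) 𝓘(ℝ, E') f x)
  d_pos : 0 < d
  l_pos : 0 < l
  finrank_eq : Module.finrank ℝ E = d + l
  finrank_distribution : ∀ x, Module.finrank ℝ (complexDistribution (E := E) S f x) = d

end Manifold

end CRGeom

end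

open scoped Manifold ContDiff

set_option maxSynthPendingDepth 3

/-! The estimate is pointwise and holds for any nonzero subspace `D` of a tangent space of an
immersed submanifold. For orthonormal `u, v` the Gauss equation and the curvature bound give
`g(R(u,v)v,u) ≤ c + ⟨h(u,u),h(v,v)⟩ - |h(u,v)|²`, and the last term can be dropped.

Given orthogonal `V_i`, choose an orthonormal basis of `D` made of bases of the `V_i` and `m = d - ∑
n_i` further vectors. Treat each `V_i` and each further vector as a block; there are `k + m` blocks.
Then `τ(D) - ∑ τ(V_i)` is the sum of sectional curvatures over ordered pairs from different blocks.
There are `d² - ∑ n_i² - m = d(d-1) - ∑ n_i(n_i-1)` such pairs. With `X_β` the trace of `h` over the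
block `β`, the quadratic terms add up to `|H|² - ∑ |X_β|²`. As `∑ X_β = H`, Cauchy–Schwarz bounds
this by `(k+m-1)/(k+m) |H|²`, and `k + m = d + k - ∑ n_i`.

This is `chenDelta_le`, fed by the Gauss equation `inner_coordCurvature_eq_secondForm`, which is
proved in charts. The factor `d²` of the theorem exactly compensates the averaging of `H`; for the
unaveraged `H` it only weakens the bound, since `d ≥ 1`. -/

namespace CRGeom

/-! ### Orthonormal frames adapted to orthogonal subspaces. -/

section AdaptedFrames

variable {T : Type*} [AddCommGroup T] [Module ℝ T] [TopologicalSpace T]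
variable {W : Type*} [AddCommGroup W] [Module ℝ W]

theorem linearIndependent_of_orthonormal {g : T →L[ℝ] T →L[ℝ] ℝ} {ι : Type*} [Fintype ι]
    [DecidableEq ι] {e : ι → T} (he : ∀ i j, g (e i) (e j) = if i = j then 1 else 0) :
    LinearIndependent ℝ e := by
  rw [Fintype.linearIndependent_iff]
  intro c hc i
  have h : g (e i) (∑ j, c j • e j) = 0 := by rw [hc, map_zero]
  simpa [map_sum, he] using h

theorem isFrame_reindex {g : T →L[ℝ] T →L[ℝ] ℝ} {V : Submodule ℝ T} {ι : Type*}
    [DecidableEq ι] {n : ℕ} {e : ι → T} (he : ∀ i j, g (e i) (e j) = if i = j then 1 else 0)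
    (hV : Submodule.span ℝ (Set.range e) = V) (σ : Fin n ≃ ι) : IsFrame g V (e ∘ σ) := by
  refine ⟨fun i j => ?_, ?_⟩
  · simp [he]
  · rw [σ.surjective.range_comp, hV]

/-- The free index type accommodates adapted frames, which are indexed by a sum of a sigma type and
`Fin m`. -/
theorem traceOn_eq_sum_of_orthonormal (g : T →L[ℝ] T →L[ℝ] ℝ) (hs : ∀ u v, g u v = g v u)
    (hp : ∀ u, u ≠ 0 → 0 < g u u) (V : Submodule ℝ T) [FiniteDimensional ℝ V]
    (B : T →ₗ[ℝ] T →ₗ[ℝ] W) {ι : Type*} [Fintype ι] [DecidableEq ι] {e : ι → T}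
    (he : ∀ i j, g (e i) (e j) = if i = j then 1 else 0)
    (hV : Submodule.span ℝ (Set.range e) = V) :
    traceOn g V (fun u v => B u v) = ∑ i, B (e i) (e i) := by
  rw [traceOn_eq_sum g hs hp V B (isFrame_reindex he hV (Fintype.equivFin ι).symm)]
  exact Equiv.sum_comp (Fintype.equivFin ι).symm fun i => B (e i) (e i)

/-- A trilinear map, as a property of the underlying function. -/
structure IsTrilinear (R : T → T → T → T) : Prop where
  left : ∀ v w, IsLinearMap ℝ fun u => R u v w
  mid : ∀ u w, IsLinearMap ℝ fun v => R u v w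
  right : ∀ u v, IsLinearMap ℝ fun w => R u v w

theorem scalarCurv_eq_sum (g : T →L[ℝ] T →L[ℝ] ℝ) (hs : ∀ u v, g u v = g v u)
    (hp : ∀ u, u ≠ 0 → 0 < g u u) {R : T → T → T → T} (hR : IsTrilinear R) (V : Submodule ℝ T)
    [FiniteDimensional ℝ V] {ι : Type*} [Fintype ι] [DecidableEq ι] {e : ι → T}
    (he : ∀ i j, g (e i) (e j) = if i = j then 1 else 0)
    (hV : Submodule.span ℝ (Set.range e) = V) :
    scalarCurv g R V = ∑ i, ∑ j, g (R (e i) (e j) (e j)) (e i) := by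
  have inner : ∀ u v, traceOn g V (fun z z' => g (R z u v) z') = ∑ i, g (R (e i) u v) (e i) :=
    fun u v => traceOn_eq_sum_of_orthonormal g hs hp V
      (LinearMap.mk₂ ℝ (fun z z' => g (R z u v) z')
        (fun a b y => by simp [(hR.left u v).map_add]) (fun r a y => by simp [(hR.left u v).map_smul])
        (by simp) (by simp)) he hV
  have outer := traceOn_eq_sum_of_orthonormal g hs hp V
      (LinearMap.mk₂ ℝ (fun u v => ∑ i, g (R (e i) u v) (e i))
        (fun a b y => by simp [(hR.mid _ y).map_add, Finset.sum_add_distrib])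
        (fun r a y => by simp [(hR.mid _ y).map_smul, Finset.mul_sum])
        (fun y a b => by simp [(hR.right _ y).map_add, Finset.sum_add_distrib])
        (fun r y a => by simp [(hR.right _ y).map_smul, Finset.mul_sum])) he hV
  simp only [LinearMap.mk₂_apply] at outer
  simp only [scalarCurv, inner, outer]
  exact Finset.sum_comm

/-- Consecutive segments of an orthonormal basis of `D` span such subspaces. Needed because the real
`sInf` of the empty set is the default value `0`. -/
theorem isOrthogonalTuple_nonempty (g : T →L[ℝ] T →L[ℝ] ℝ) (hs : ∀ u v, g u v = g v u)
    (hp : ∀ u, u ≠ 0 → 0 < g u u) (D : Submodule ℝ T) [FiniteDimensional ℝ D] {k : ℕ}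
    (n : Fin k → ℕ) (hn : ∑ i, n i ≤ Module.finrank ℝ D) : ∃ V, IsOrthogonalTuple g D n V := by
  obtain ⟨e, he⟩ := exists_isFrame g hs hp D
  let j : (Σ i, Fin (n i)) → Fin (Module.finrank ℝ D) := fun a => Fin.castLE hn (finSigmaFinEquiv a)
  have hj : Function.Injective j := (Fin.castLE_injective hn).comp finSigmaFinEquiv.injective
  have ho : ∀ a b, g (e (j a)) (e (j b)) = if a = b then 1 else 0 := fun a b => by
    rw [he.1]; simp [hj.eq_iff]
  have hli := linearIndependent_of_orthonormal ho
  refine ⟨fun i => Submodule.span ℝ (Set.range fun b : Fin (n i) => e (j ⟨i, b⟩)), fun i => ?_,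
    fun i => ?_, fun i i' hii u hu v hv => ?_⟩
  · rw [Submodule.span_le]
    rintro _ ⟨b, rfl⟩
    rw [← he.2]
    exact Submodule.subset_span ⟨_, rfl⟩
  · have := finrank_span_eq_card (hli.comp (fun b : Fin (n i) => (⟨i, b⟩ : Σ i, Fin (n i)))
      fun a b hab => by simpa using hab)
    simpa [Function.comp_def] using this
  · induction hu using Submodule.span_induction with
    | zero => simp
    | add x y _ _ hx hy => simp [hx, hy]
    | smul r x _ hx => simp [hx]
    | mem x hx =>
      obtain ⟨b, rfl⟩ := hx
      induction hv using Submodule.span_induction with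
      | zero => simp
      | add x y _ _ hx hy => simp [hx, hy]
      | smul r x _ hx => simp [hx]
      | mem x hx =>
        obtain ⟨b', rfl⟩ := hx
        simp [ho, hii]

/-- The subspace of all vectors of `D` which are `g`-orthogonal to a family `e`. -/
noncomputable def orthogonalIn (g : T →L[ℝ] T →L[ℝ] ℝ) (D : Submodule ℝ T) {ι : Type*} (e : ι → T) :
    Submodule ℝ T :=
  D ⊓ ⨅ i, LinearMap.ker (g (e i)).toLinearMap

theorem mem_orthogonalIn {g : T →L[ℝ] T →L[ℝ] ℝ} {D : Submodule ℝ T} {ι : Type*} {e : ι → T}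
    {u : T} : u ∈ orthogonalIn g D e ↔ u ∈ D ∧ ∀ i, g (e i) u = 0 := by
  simp [orthogonalIn]

/-- Frames of the `V i` are completed by a frame of their orthogonal complement in `D`; subtracting
the projection onto the former puts any vector of `D` into that complement. -/
theorem exists_adapted_frame (g : T →L[ℝ] T →L[ℝ] ℝ) (hs : ∀ u v, g u v = g v u)
    (hp : ∀ u, u ≠ 0 → 0 < g u u) (D : Submodule ℝ T) [FiniteDimensional ℝ D] {k : ℕ}
    {n : Fin k → ℕ} {V : Fin k → Submodule ℝ T} (hV : IsOrthogonalTuple g D n V) :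
    ∃ (m : ℕ) (e : (Σ i, Fin (n i)) ⊕ Fin m → T),
      (∀ a b, g (e a) (e b) = if a = b then 1 else 0) ∧ Submodule.span ℝ (Set.range e) = D ∧
      ∀ i, IsFrame g (V i) fun b => e (Sum.inl ⟨i, b⟩) := by
  have hfr : ∀ i, ∃ e : Fin (n i) → T, IsFrame g (V i) e := fun i => by
    have : FiniteDimensional ℝ (V i) := Submodule.finiteDimensional_of_le (hV.1 i)
    obtain ⟨e, he⟩ := exists_isFrame g hs hp (V i)
    exact ⟨e ∘ finCongr (hV.2.1 i).symm, isFrame_reindex he.1 he.2 _⟩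
  choose ε hε using hfr
  have hεV : ∀ i b, ε i b ∈ V i := fun i b => by
    rw [← (hε i).2]; exact Submodule.subset_span ⟨b, rfl⟩
  let e₁ : (Σ i, Fin (n i)) → T := fun a => ε a.1 a.2
  let P := orthogonalIn g D e₁
  have : FiniteDimensional ℝ P := Submodule.finiteDimensional_of_le inf_le_left
  obtain ⟨p, hpP⟩ := exists_isFrame g hs hp P
  have hpm : ∀ b, p b ∈ P := fun b => by
    rw [← hpP.2]; exact Submodule.subset_span ⟨b, rfl⟩
  have h11 : ∀ a b, g (e₁ a) (e₁ b) = if a = b then 1 else 0 := by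
    rintro ⟨i, a⟩ ⟨j, b⟩
    by_cases hij : i = j
    · subst hij
      simp [e₁, (hε i).1]
    · have : (⟨i, a⟩ : Σ i, Fin (n i)) ≠ ⟨j, b⟩ := fun h => hij (congrArg Sigma.fst h)
      rw [if_neg this]
      exact hV.2.2 i j hij _ (hεV i a) _ (hεV j b)
  have h12 : ∀ a b, g (e₁ a) (p b) = 0 := fun a b => (mem_orthogonalIn.1 (hpm b)).2 a
  have ho : ∀ a b, g (Sum.elim e₁ p a) (Sum.elim e₁ p b) = if a = b then 1 else 0 := by
    rintro (a | a) (b | b)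
    · simp [h11]
    · simp [h12]
    · simp [hs (p a), h12]
    · simp [hpP.1]
  refine ⟨_, Sum.elim e₁ p, ho, le_antisymm ?_ fun u hu => ?_, fun i => hε i⟩
  · rw [Submodule.span_le]
    rintro _ ⟨a | a, rfl⟩
    · exact hV.1 _ (hεV _ _)
    · exact (mem_orthogonalIn.1 (hpm a)).1
  · have h1 : u - ∑ a, g (e₁ a) u • e₁ a ∈ P := by
      refine mem_orthogonalIn.2 ⟨D.sub_mem hu (D.sum_mem fun a _ => D.smul_mem _
        (hV.1 _ (hεV _ _))), fun a => ?_⟩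
      simp [map_sum, h11]
    rw [← hpP.2] at h1
    have h2 : ∑ a, g (e₁ a) u • e₁ a ∈ Submodule.span ℝ (Set.range (Sum.elim e₁ p)) :=
      Submodule.sum_mem _ fun a _ => Submodule.smul_mem _ _ (Submodule.subset_span ⟨Sum.inl a, rfl⟩)
    have h3 : Submodule.span ℝ (Set.range p) ≤ Submodule.span ℝ (Set.range (Sum.elim e₁ p)) :=
      Submodule.span_mono (by rintro _ ⟨b, rfl⟩; exact ⟨Sum.inr b, rfl⟩)
    simpa using Submodule.add_mem _ (h3 h1) h2

end AdaptedFrames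

/-! ### The algebraic Chen inequality in one tangent space. -/

section ChenInequality

/-- `Sum.map Sigma.fst id` sends an index to its block: the index `i` of `V i`, or a leftover vector
taken alone. -/
theorem sum_same_block {k m : ℕ} {n : Fin k → ℕ}
    (q : (Σ i, Fin (n i)) ⊕ Fin m → (Σ i, Fin (n i)) ⊕ Fin m → ℝ) :
    (∑ a, ∑ b, if Sum.map Sigma.fst id a = Sum.map Sigma.fst id b then q a b else 0) =
      (∑ i, ∑ x, ∑ y, q (Sum.inl ⟨i, x⟩) (Sum.inl ⟨i, y⟩)) +
        ∑ j, q (Sum.inr j) (Sum.inr j) := by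
  simp only [Fintype.sum_sum_type, Fintype.sum_sigma, Sum.map_inl, Sum.map_inr, Sum.inl.injEq,
    Sum.inr.injEq, reduceCtorEq, if_false, Finset.sum_const_zero, add_zero, zero_add, id]
  congr 1
  · refine Finset.sum_congr rfl fun i _ => Finset.sum_congr rfl fun x _ => ?_
    rw [Finset.sum_eq_single i]
    · simp
    · intro j _ hj
      simp [hj.symm]
    · simp
  · simp

variable {T : Type*} [AddCommGroup T] [Module ℝ T] [TopologicalSpace T]
variable {W : Type*} [AddCommGroup W] [Module ℝ W] [TopologicalSpace W]

/-- Cauchy–Schwarz, by expanding `0 ≤ ∑ᵢ ∑ⱼ |Xᵢ - Xⱼ|²`. -/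
theorem sq_sum_le_card_mul_sum_sq (B : W →L[ℝ] W →L[ℝ] ℝ) (hB : ∀ u v, B u v = B v u)
    (hB0 : ∀ u, 0 ≤ B u u) {κ : Type*} [Fintype κ] (X : κ → W) :
    B (∑ i, X i) (∑ i, X i) ≤ Fintype.card κ * ∑ i, B (X i) (X i) := by
  have h : 0 ≤ ∑ i, ∑ j, B (X i - X j) (X i - X j) :=
    Finset.sum_nonneg fun i _ => Finset.sum_nonneg fun j _ => hB0 _
  have h1 : B (∑ i, X i) (∑ i, X i) = ∑ i, ∑ j, B (X i) (X j) := by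
    simp only [map_sum, _root_.sum_apply]
    exact Finset.sum_comm
  have h2 : ∀ i j, B (X i - X j) (X i - X j) = B (X i) (X i) + B (X j) (X j) - 2 * B (X i) (X j) := by
    intro i j
    simp only [map_sub, _root_.sub_apply, hB (X j) (X i)]
    ring
  simp only [h2, Finset.sum_sub_distrib, Finset.sum_add_distrib, ← Finset.mul_sum, ← h1,
    Finset.sum_const, Finset.card_univ, nsmul_eq_mul] at h
  linarith

/-- All geometry is condensed in `hRc`, the Gauss equation combined with the ambient curvature
bound; what remains is the block count and Cauchy–Schwarz. -/
theorem chenDelta_le (g : T →L[ℝ] T →L[ℝ] ℝ) (hs : ∀ u v, g u v = g v u)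
    (hp : ∀ u, u ≠ 0 → 0 < g u u) {R : T → T → T → T} (hR : IsTrilinear R)
    (hR0 : ∀ u v, R u u v = 0) (B : W →L[ℝ] W →L[ℝ] ℝ) (hB : ∀ u v, B u v = B v u)
    (hB0 : ∀ u, 0 ≤ B u u) (h : T →ₗ[ℝ] T →ₗ[ℝ] W) (c : ℝ)
    (hRc : ∀ u v, g u u = 1 → g v v = 1 → g u v = 0 →
      g (R u v v) u ≤ c + (B (h u u) (h v v) - B (h u v) (h u v)))
    (D : Submodule ℝ T) [FiniteDimensional ℝ D] (hD : 0 < Module.finrank ℝ D) {k : ℕ}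
    (n : Fin k → ℕ) (hn : ∑ i, n i ≤ Module.finrank ℝ D) :
    chenDelta g R D n ≤
      (Module.finrank ℝ D + k - 1 - ∑ i, (n i : ℝ)) /
          (2 * (Module.finrank ℝ D + k - ∑ i, (n i : ℝ))) *
        B (traceOn g D fun u v => h u v) (traceOn g D fun u v => h u v) +
      c / 2 * (Module.finrank ℝ D * (Module.finrank ℝ D - 1) - ∑ i, (n i : ℝ) * (n i - 1)) := by
  set d := Module.finrank ℝ D with hd
  set H := traceOn g D fun u v => h u v with hH
  set s : ℝ := ∑ i, (n i : ℝ) with hs'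
  suffices hmain : ∀ V, IsOrthogonalTuple g D n V →
      scalarCurv g R D - ∑ i, scalarCurv g R (V i) ≤
        (d + k - 1 - s) / (d + k - s) * B H H + c * (d * (d - 1) - ∑ i, (n i : ℝ) * (n i - 1)) by
    obtain ⟨V₀, hV₀⟩ := isOrthogonalTuple_nonempty g hs hp D n hn
    have hinf : scalarCurv g R D - ((d + k - 1 - s) / (d + k - s) * B H H +
        c * (d * (d - 1) - ∑ i, (n i : ℝ) * (n i - 1))) ≤
        sInf {t : ℝ | ∃ V, IsOrthogonalTuple g D n V ∧ t = ∑ i, scalarCurv g R (V i)} := by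
      refine le_csInf ⟨_, V₀, hV₀, rfl⟩ ?_
      rintro _ ⟨V, hV, rfl⟩
      linarith [hmain V hV]
    have e1 : (d + k - 1 - s) / (2 * (d + k - s)) = (d + k - 1 - s) / (d + k - s) / 2 := by
      rw [div_div, mul_comm]
    rw [chenDelta, e1]
    linarith
  intro V hV
  obtain ⟨m, e, he, hspan, heV⟩ := exists_adapted_frame g hs hp D hV
  have hdim : (d : ℝ) = s + m := by
    have h1 := finrank_span_eq_card (linearIndependent_of_orthonormal he)
    rw [hspan] at h1
    have h2 : d = ∑ i, n i + m := by simpa using h1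
    rw [h2]
    push_cast
    rfl
  have hVi : ∀ i, scalarCurv g R (V i) = ∑ x, ∑ y, g (R (e (Sum.inl ⟨i, x⟩)) (e (Sum.inl ⟨i, y⟩))
      (e (Sum.inl ⟨i, y⟩))) (e (Sum.inl ⟨i, x⟩)) := fun i => by
    have : FiniteDimensional ℝ (V i) := Submodule.finiteDimensional_of_le (hV.1 i)
    exact scalarCurv_eq_sum g hs hp hR (V i) (heV i).1 (heV i).2
  have hblock := sum_same_block fun a b => g (R (e a) (e b) (e b)) (e a)
  -- Singleton blocks contribute `g(R(e,e)e,e) = 0`, so the same-block sum is exactly `∑ τ(V i)`.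
  simp only [hR0, map_zero, _root_.zero_apply, Finset.sum_const_zero, add_zero] at hblock
  have hblock' := sum_same_block fun a b => c + B (h (e a) (e a)) (h (e b) (e b))
  -- Same-block pairs cancel on each side; indices in different blocks are distinct, so `hRc`
  -- applies to their vectors.
  have hle : scalarCurv g R D - ∑ i, scalarCurv g R (V i) ≤
      (∑ a, ∑ b, (c + B (h (e a) (e a)) (h (e b) (e b)))) -
      ∑ a, ∑ b, if Sum.map Sigma.fst id a = Sum.map Sigma.fst id b then
        c + B (h (e a) (e a)) (h (e b) (e b)) else 0 := by
    rw [scalarCurv_eq_sum g hs hp hR D he hspan, Finset.sum_congr rfl fun i _ => hVi i, ← hblock]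
    simp only [← Finset.sum_sub_distrib]
    refine Finset.sum_le_sum fun a _ => Finset.sum_le_sum fun b _ => ?_
    split_ifs with hab
    · simp
    · have hne : a ≠ b := fun h => hab (by rw [h])
      have := hRc (e a) (e b) (by simp [he]) (by simp [he]) (by simp [he, hne])
      linarith [hB0 (h (e a) (e b))]
  rw [hblock'] at hle
  -- The trace of `h` over each of the `k + m` blocks.
  let X : Fin k ⊕ Fin m → W := Sum.elim
    (fun i => ∑ x : Fin (n i), h (e (Sum.inl ⟨i, x⟩)) (e (Sum.inl ⟨i, x⟩)))
    (fun j => h (e (Sum.inr j)) (e (Sum.inr j)))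
  have hHX : H = ∑ a, X a := by
    rw [hH, traceOn_eq_sum_of_orthonormal g hs hp D h he hspan]
    simp [X, Fintype.sum_sigma]
  have hHe : ∑ a, h (e a) (e a) = H := by
    rw [hH, traceOn_eq_sum_of_orthonormal g hs hp D h he hspan]
  have hCS := sq_sum_le_card_mul_sum_sq B hB hB0 X
  rw [← hHX] at hCS
  have hdouble : ∀ {ι : Type} [Fintype ι] (Y : ι → W),
      ∑ a, ∑ b, (c + B (Y a) (Y b)) = (Fintype.card ι : ℝ) ^ 2 * c + B (∑ a, Y a) (∑ a, Y a) := by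
    intro ι _ Y
    simp only [map_sum, _root_.sum_apply, Finset.sum_add_distrib, Finset.sum_const,
      Finset.card_univ, nsmul_eq_mul]
    rw [Finset.sum_comm]
    ring
  rw [hdouble fun a => h (e a) (e a), hHe, Finset.sum_congr rfl fun i _ =>
    hdouble fun x : Fin (n i) => h (e (Sum.inl ⟨i, x⟩)) (e (Sum.inl ⟨i, x⟩))] at hle
  have hXsum : ∑ a, B (X a) (X a) = (∑ i : Fin k, B (X (Sum.inl i)) (X (Sum.inl i))) +
      ∑ j : Fin m, B (h (e (Sum.inr j)) (e (Sum.inr j))) (h (e (Sum.inr j)) (e (Sum.inr j))) := by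
    rw [Fintype.sum_sum_type]; rfl
  have hXl : ∀ i : Fin k, X (Sum.inl i) = ∑ x : Fin (n i), h (e (Sum.inl ⟨i, x⟩))
    (e (Sum.inl ⟨i, x⟩)) := fun i => rfl
  simp only [Finset.sum_add_distrib, ← hXl, Fintype.card_fin, Fintype.card_sum,
    Fintype.card_sigma, Finset.sum_const, Finset.card_univ, nsmul_eq_mul, Nat.cast_add,
    Nat.cast_sum, ← hs', ← hdim, ← Finset.sum_mul] at hle hCS
  -- If `k = 0`, then `m = d > 0`.
  have hpos : (0 : ℝ) < k + m := by
    have h0 : 0 < k + m := by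
      rcases Nat.eq_zero_or_pos k with rfl | hk
      · have : s = 0 := by simp [hs']
        have : (d : ℝ) = m := by rw [hdim, this, zero_add]
        have : d = m := by exact_mod_cast this
        omega
      · omega
    exact_mod_cast h0
  have hden : (d : ℝ) + k - s = k + m := by rw [hdim]; ring
  have hnum : (d : ℝ) + k - 1 - s = k + m - 1 := by rw [hdim]; ring
  rw [hden, hnum]
  have hB' : B H H / (k + m) ≤ ∑ a, B (X a) (X a) := by
    rw [div_le_iff₀ hpos]; linarith
  have hcoef : ((k : ℝ) + m - 1) / (k + m) * B H H = B H H - B H H / (k + m) := by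
    field_simp
  have hnn : ∑ i, (n i : ℝ) * (n i - 1) = ∑ i, (n i : ℝ) ^ 2 - s := by
    rw [hs', ← Finset.sum_sub_distrib]
    exact Finset.sum_congr rfl fun i _ => by ring
  rw [hcoef, hnn]
  rw [hXsum] at hB'
  have : (m : ℝ) = d - s := by rw [hdim]; ring
  rw [this] at hle
  linarith

end ChenInequality

end CRGeom

namespace CRGeom

/-! ### The Levi-Civita connection and the Gauss equation in coordinates. -/

section Coordinates

open Filter Topology

variable {E : Type*} [NormedAddCommGroup E] [NormedSpace ℝ E]
variable {E' : Type*} [NormedAddCommGroup E'] [NormedSpace ℝ E']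

/-- The Christoffel symbols of the first kind of a metric with derivative `A`. -/
noncomputable def christoffelForm (A : E →L[ℝ] E →L[ℝ] E →L[ℝ] ℝ) : E →L[ℝ] E →L[ℝ] E →L[ℝ] ℝ :=
  (1 / 2 : ℝ) • (A + A.flip -
    (ContinuousLinearMap.flipₗᵢ ℝ E E ℝ).toContinuousLinearEquiv.toContinuousLinearMap ∘L A.flip)

theorem christoffelForm_apply (A : E →L[ℝ] E →L[ℝ] E →L[ℝ] ℝ) (u v w : E) :
    christoffelForm A u v w = 1 / 2 * (A u v w + A v u w - A w u v) := by
  simp [christoffelForm]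

theorem contDiff_christoffelForm {n : ℕ∞ω} :
    ContDiff ℝ n (christoffelForm : (E →L[ℝ] E →L[ℝ] E →L[ℝ] ℝ) → _) := by
  have hflip : ContDiff ℝ n fun A : E →L[ℝ] E →L[ℝ] E →L[ℝ] ℝ => A.flip :=
    (ContinuousLinearMap.flipₗᵢ ℝ E E (E →L[ℝ] ℝ)).contDiff
  exact ContDiff.const_smul (1 / 2 : ℝ)
    ((contDiff_id.add hflip).sub (contDiff_const.clm_comp hflip))

/-- The Christoffel symbols of the Levi-Civita connection of `G` as a bilinear map. -/
noncomputable def christoffelMap (G : E → E →L[ℝ] E →L[ℝ] ℝ) (p : E) : E →L[ℝ] E →L[ℝ] E :=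
  ContinuousLinearMap.compL ℝ E (E →L[ℝ] ℝ) E (G p).inverse ∘L christoffelForm (fderiv ℝ G p)

theorem christoffelMap_apply (G : E → E →L[ℝ] E →L[ℝ] ℝ) (p u v : E) :
    christoffelMap G p u v = christoffel G p u v := by
  simp only [christoffelMap, christoffel, ContinuousLinearMap.comp_apply,
    ContinuousLinearMap.compL_apply]
  congr 1

/-- `G` is a `C²` Riemannian metric near `p`. -/
structure IsLocalMetric (G : E → E →L[ℝ] E →L[ℝ] ℝ) (p : E) : Prop where
  smooth : ContDiffAt ℝ 2 G p
  symm : ∀ᶠ q in 𝓝 p, ∀ u v, G q u v = G q v u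
  pos : ∀ᶠ q in 𝓝 p, ∀ u, u ≠ 0 → 0 < G q u u

namespace IsLocalMetric

variable {G : E → E →L[ℝ] E →L[ℝ] ℝ} {p : E} (hG : IsLocalMetric G p)

include hG

/-- Lets identities proved at a point hold nearby, so that they can be differentiated. -/
theorem eventually : ∀ᶠ q in 𝓝 p, IsLocalMetric G q := by
  filter_upwards [hG.smooth.eventually (by decide), hG.symm.eventually_nhds,
    hG.pos.eventually_nhds] with q h1 h2 h3 using ⟨h1, h2, h3⟩

theorem symm_fderiv (u v w : E) : fderiv ℝ G p u v w = fderiv ℝ G p u w v := by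
  have hd := (hG.smooth.differentiableAt (by decide)).hasFDerivAt
  have h1 := (hd.clm_apply (hasFDerivAt_const v p)).clm_apply (hasFDerivAt_const w p)
  have h2 := (hd.clm_apply (hasFDerivAt_const w p)).clm_apply (hasFDerivAt_const v p)
  have h3 := h2.congr_of_eventuallyEq (hG.symm.mono fun q hq => hq v w)
  simpa using DFunLike.congr_fun (h1.unique h3) u

variable [FiniteDimensional ℝ E]

/-- Definiteness gives injectivity into a dual of equal dimension. Without invertibility `inverse`
would be the default `0`. -/
theorem isInvertible : (G p).IsInvertible := by
  have hinj : Function.Injective (G p).toLinearMap := by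
    refine (injective_iff_map_eq_zero _).2 fun u hu => ?_
    by_contra h
    have h1 := hG.pos.self_of_nhds u h
    have h2 : G p u = 0 := hu
    simp [h2] at h1
  have hfr : Module.finrank ℝ E = Module.finrank ℝ (E →L[ℝ] ℝ) := by
    rw [← (LinearMap.toContinuousLinearMap : (E →ₗ[ℝ] ℝ) ≃ₗ[ℝ] E →L[ℝ] ℝ).finrank_eq]
    exact (Subspace.dual_finrank_eq (K := ℝ) (V := E)).symm
  exact ⟨(LinearMap.linearEquivOfInjective _ hinj hfr).toContinuousLinearEquiv, by ext; rfl⟩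

/-- The Koszul formula for constant fields. -/
theorem inner_christoffel (u v w : E) : G p (christoffelMap G p u v) w =
    1 / 2 * (fderiv ℝ G p u v w + fderiv ℝ G p v u w - fderiv ℝ G p w u v) := by
  simp only [christoffelMap, ContinuousLinearMap.comp_apply, ContinuousLinearMap.compL_apply]
  rw [hG.isInvertible.self_apply_inverse, christoffelForm_apply]

omit [FiniteDimensional ℝ E] in
theorem eq_zero_of_inner_eq_zero {a : E} (h : ∀ w, G p a w = 0) : a = 0 := by
  by_contra h0
  exact (hG.pos.self_of_nhds a h0).ne' (h a)

theorem christoffel_symm (u v : E) : christoffelMap G p u v = christoffelMap G p v u := by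
  refine sub_eq_zero.1 (hG.eq_zero_of_inner_eq_zero fun w => ?_)
  rw [map_sub, _root_.sub_apply, hG.inner_christoffel, hG.inner_christoffel, hG.symm_fderiv w u v]
  ring

/-- Metric compatibility: two Koszul formulas are added. -/
theorem fderiv_apply_eq (u v w : E) : fderiv ℝ G p u v w =
    G p (christoffelMap G p u v) w + G p v (christoffelMap G p u w) := by
  rw [hG.symm.self_of_nhds v, hG.inner_christoffel, hG.inner_christoffel, hG.symm_fderiv u w v,
    hG.symm_fderiv v u w, hG.symm_fderiv w u v]
  ring

theorem contDiffAt_christoffelMap : ContDiffAt ℝ 1 (christoffelMap G) p := by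
  have : CompleteSpace E := FiniteDimensional.complete ℝ E
  have h1 : ContDiffAt ℝ 1 (fun q => (G q).inverse) p :=
    (hG.isInvertible.contDiffAt_map_inverse (n := 1)).comp p (hG.smooth.of_le (by decide))
  have h2 : ContDiffAt ℝ 1 (fun q => christoffelForm (fderiv ℝ G q)) p :=
    contDiff_christoffelForm.contDiffAt.comp p (hG.smooth.fderiv_right (by norm_num))
  exact ((ContinuousLinearMap.compL ℝ E (E →L[ℝ] ℝ) E).contDiff.contDiffAt.comp p h1).clm_comp h2

theorem hasFDerivAt_christoffelMap :
    HasFDerivAt (christoffelMap G) (fderiv ℝ (christoffelMap G) p) p :=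
  (hG.contDiffAt_christoffelMap.differentiableAt (by decide)).hasFDerivAt

theorem coordCurvature_eq (u v w : E) : coordCurvature G p u v w =
    fderiv ℝ (christoffelMap G) p u v w - fderiv ℝ (christoffelMap G) p v u w
      + christoffelMap G p u (christoffelMap G p v w)
      - christoffelMap G p v (christoffelMap G p u w) := by
  have h : ∀ v w u, fderiv ℝ (fun q => christoffel G q v w) p u =
      fderiv ℝ (christoffelMap G) p u v w := fun v w u => by
    have h1 := (hG.hasFDerivAt_christoffelMap.clm_apply (hasFDerivAt_const v p)).clm_apply
      (hasFDerivAt_const w p)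
    simp only [christoffelMap_apply] at h1
    rw [h1.fderiv]
    simp
  simp only [coordCurvature, h, christoffelMap_apply]

theorem isTrilinear_coordCurvature : IsTrilinear (coordCurvature G p) := by
  constructor <;> intro a b <;> constructor <;> intros <;>
    simp only [hG.coordCurvature_eq, map_add, map_smul, _root_.add_apply, _root_.smul_apply,
      smul_sub, smul_add] <;> abel

end IsLocalMetric

theorem coordCurvature_self (G : E → E →L[ℝ] E →L[ℝ] ℝ) (p u v : E) :
    coordCurvature G p u u v = 0 := by
  simp [coordCurvature]

/-- `∇̄_v (dF w)` for constant fields `v, w`. -/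
noncomputable def covDerivAlong (G : E' → E' →L[ℝ] E' →L[ℝ] ℝ) (F : E → E') (p v w : E) : E' :=
  fderiv ℝ (fderiv ℝ F) p v w + christoffelMap G (F p) (fderiv ℝ F p v) (fderiv ℝ F p w)

section Immersion

variable [FiniteDimensional ℝ E] [FiniteDimensional ℝ E'] {G : E → E →L[ℝ] E →L[ℝ] ℝ}
  {G' : E' → E' →L[ℝ] E' →L[ℝ] ℝ} {F : E → E'} {p : E}

omit [FiniteDimensional ℝ E] [FiniteDimensional ℝ E'] in
theorem isSymm_fderiv_fderiv (hF : ContDiffAt ℝ 2 F p) (u v : E) :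
    fderiv ℝ (fderiv ℝ F) p u v = fderiv ℝ (fderiv ℝ F) p v u :=
  hF.isSymmSndFDerivAt (by simp) u v

omit [FiniteDimensional ℝ E] [FiniteDimensional ℝ E'] in
-- One derivative of `F` enters the pulled-back metric, hence `C³` for `F` against `C²` for `G`.
theorem isLocalMetric_pullback (hG' : IsLocalMetric G' (F p)) (hF : ContDiffAt ℝ 3 F p)
    (hinj : ∀ᶠ q in 𝓝 p, Function.Injective (fderiv ℝ F q))
    (hG : ∀ᶠ q in 𝓝 p, ∀ u v, G q u v = G' (F q) (fderiv ℝ F q u) (fderiv ℝ F q v)) :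
    IsLocalMetric G p := by
  refine ⟨?_, ?_, ?_⟩
  · have h1 : ContDiffAt ℝ 2 (fun q => G' (F q)) p := hG'.smooth.comp p (hF.of_le (by decide))
    have h2 : ContDiffAt ℝ 2 (fderiv ℝ F) p := hF.fderiv_right (by norm_num)
    have h3 := (ContinuousLinearMap.flipₗᵢ ℝ E E' ℝ).contDiff.contDiffAt.comp p (h1.clm_comp h2)
    have h4 := (ContinuousLinearMap.flipₗᵢ ℝ E E ℝ).contDiff.contDiffAt.comp p (h3.clm_comp h2)
    refine h4.congr_of_eventuallyEq (hG.mono fun q hq => ?_)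
    ext u v
    simp [hq]
  · filter_upwards [hG, hF.continuousAt.eventually hG'.symm] with q h1 h2 u v
    rw [h1, h1, h2]
  · filter_upwards [hG, hF.continuousAt.eventually hG'.pos, hinj] with q h1 h2 h3 u hu
    rw [h1]
    exact h2 _ fun h => hu (h3 (by rw [h, map_zero]))

omit [FiniteDimensional ℝ E] in
theorem covDerivAlong_symm (hG' : IsLocalMetric G' (F p)) (hF : ContDiffAt ℝ 2 F p) (u v : E) :
    covDerivAlong G' F p u v = covDerivAlong G' F p v u := by
  rw [covDerivAlong, covDerivAlong, isSymm_fderiv_fderiv hF, hG'.christoffel_symm]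

/-- The induced connection is the tangential part of the ambient one: differentiate the pullback
identity, insert it into the Koszul formula, and cancel second derivatives of `F` by symmetry. -/
theorem inner_christoffel_pullback (hG' : IsLocalMetric G' (F p)) (hF : ContDiffAt ℝ 2 F p)
    (hGp : IsLocalMetric G p)
    (hG : ∀ᶠ q in 𝓝 p, ∀ u v, G q u v = G' (F q) (fderiv ℝ F q u) (fderiv ℝ F q v)) (v w z : E) :
    G p (christoffelMap G p v w) z = G' (F p) (covDerivAlong G' F p v w) (fderiv ℝ F p z) := by
  have hdF := (hF.differentiableAt (by decide)).hasFDerivAt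
  have hddF := ((hF.fderiv_right (m := 1) (by norm_num)).differentiableAt (by decide)).hasFDerivAt
  have hdG := (hGp.smooth.differentiableAt (by decide)).hasFDerivAt
  have hdG' := (hG'.smooth.differentiableAt (by decide)).hasFDerivAt
  have key : ∀ u v w, fderiv ℝ G p u v w =
      fderiv ℝ G' (F p) (fderiv ℝ F p u) (fderiv ℝ F p v) (fderiv ℝ F p w) +
      G' (F p) (fderiv ℝ (fderiv ℝ F) p u v) (fderiv ℝ F p w) +
      G' (F p) (fderiv ℝ F p v) (fderiv ℝ (fderiv ℝ F) p u w) := fun u v w => by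
    have h1 := (hdG.clm_apply (hasFDerivAt_const v p)).clm_apply (hasFDerivAt_const w p)
    have h2 := ((hdG'.comp p hdF).clm_apply (hddF.clm_apply (hasFDerivAt_const v p))).clm_apply
      (hddF.clm_apply (hasFDerivAt_const w p))
    have h3 := h2.congr_of_eventuallyEq (hG.mono fun q hq => hq v w)
    have h4 := DFunLike.congr_fun (h1.unique h3) u
    simp at h4
    linarith
  have hs := hG'.symm.self_of_nhds
  rw [hGp.inner_christoffel, covDerivAlong, map_add, _root_.add_apply, hG'.inner_christoffel, key,
    key, key, isSymm_fderiv_fderiv hF w v, isSymm_fderiv_fderiv hF z v, isSymm_fderiv_fderiv hF z w,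
    hs _ (fderiv ℝ (fderiv ℝ F) p v z)]
  ring

omit [FiniteDimensional ℝ E] in
theorem hasFDerivAt_covDerivAlong (hG' : IsLocalMetric G' (F p)) (hF : ContDiffAt ℝ 3 F p)
    (v w : E) : ∃ L : E →L[ℝ] E', HasFDerivAt (fun q => covDerivAlong G' F q v w) L p ∧
      ∀ u, L u = fderiv ℝ (fderiv ℝ (fderiv ℝ F)) p u v w +
        fderiv ℝ (christoffelMap G') (F p) (fderiv ℝ F p u) (fderiv ℝ F p v) (fderiv ℝ F p w) +
        christoffelMap G' (F p) (fderiv ℝ (fderiv ℝ F) p u v) (fderiv ℝ F p w) +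
        christoffelMap G' (F p) (fderiv ℝ F p v) (fderiv ℝ (fderiv ℝ F) p u w) := by
  have hdF := (hF.differentiableAt (by decide)).hasFDerivAt
  have hF1 : ContDiffAt ℝ 2 (fderiv ℝ F) p := hF.fderiv_right (by norm_num)
  have hddF := (hF1.differentiableAt (by decide)).hasFDerivAt
  have hdddF := ((hF1.fderiv_right (m := 1) (by norm_num)).differentiableAt
    (by decide)).hasFDerivAt
  have h1 := (hdddF.clm_apply (hasFDerivAt_const v p)).clm_apply (hasFDerivAt_const w p)
  have h2 := ((hG'.hasFDerivAt_christoffelMap.comp p hdF).clm_apply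
    (hddF.clm_apply (hasFDerivAt_const v p))).clm_apply (hddF.clm_apply (hasFDerivAt_const w p))
  refine ⟨_, h1.add h2, fun u => ?_⟩
  simp
  abel

/-- The Gauss equation before splitting off normal parts: differentiate `⟨∇_v w, z⟩ = ⟨∇̄_v dF w, dF
z⟩` along `u` and antisymmetrise in `u, v`. -/
theorem inner_coordCurvature_pullback (hG' : IsLocalMetric G' (F p)) (hF : ContDiffAt ℝ 3 F p)
    (hinj : ∀ᶠ q in 𝓝 p, Function.Injective (fderiv ℝ F q))
    (hG : ∀ᶠ q in 𝓝 p, ∀ u v, G q u v = G' (F q) (fderiv ℝ F q u) (fderiv ℝ F q v))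
    (u v w z : E) :
    G p (coordCurvature G p u v w) z =
      G' (F p) (coordCurvature G' (F p) (fderiv ℝ F p u) (fderiv ℝ F p v) (fderiv ℝ F p w))
        (fderiv ℝ F p z) +
      G' (F p) (covDerivAlong G' F p v w) (covDerivAlong G' F p u z) -
      G' (F p) (covDerivAlong G' F p u w) (covDerivAlong G' F p v z) -
      G p (christoffelMap G p v w) (christoffelMap G p u z) +
      G p (christoffelMap G p u w) (christoffelMap G p v z) := by
  have hGp := isLocalMetric_pullback hG' hF hinj hG
  have hF1 : ContDiffAt ℝ 2 (fderiv ℝ F) p := hF.fderiv_right (by norm_num)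
  have hdF := (hF.differentiableAt (by decide)).hasFDerivAt
  have hddF := (hF1.differentiableAt (by decide)).hasFDerivAt
  have hdG := (hGp.smooth.differentiableAt (by decide)).hasFDerivAt
  have hdG' := (hG'.smooth.differentiableAt (by decide)).hasFDerivAt
  have hev : ∀ v w z, ∀ᶠ q in 𝓝 p, G q (christoffelMap G q v w) z =
      G' (F q) (covDerivAlong G' F q v w) (fderiv ℝ F q z) := fun v w z => by
    filter_upwards [hGp.eventually, hF.continuousAt.eventually hG'.eventually,
      (hF.of_le (m := 2) (by decide)).eventually (by decide), hG.eventually_nhds]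
      with q h1 h2 h3 h4 using inner_christoffel_pullback h2 h3 h1 h4 v w z
  -- Metric compatibility on both sides turns derivatives of the metrics into connection terms: the
  -- left vector is `∇_u ∇_v w`, the right one `∇̄_u ∇̄_v (dF w)`.
  have key : ∀ u v w, G p (fderiv ℝ (christoffelMap G) p u v w +
        christoffelMap G p u (christoffelMap G p v w)) z =
      G' (F p) (fderiv ℝ (fderiv ℝ (fderiv ℝ F)) p u v w +
        fderiv ℝ (christoffelMap G') (F p) (fderiv ℝ F p u) (fderiv ℝ F p v) (fderiv ℝ F p w) +
        christoffelMap G' (F p) (fderiv ℝ (fderiv ℝ F) p u v) (fderiv ℝ F p w) +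
        christoffelMap G' (F p) (fderiv ℝ F p v) (fderiv ℝ (fderiv ℝ F) p u w) +
        christoffelMap G' (F p) (fderiv ℝ F p u) (covDerivAlong G' F p v w)) (fderiv ℝ F p z) +
      G' (F p) (covDerivAlong G' F p v w) (covDerivAlong G' F p u z) -
      G p (christoffelMap G p v w) (christoffelMap G p u z) := fun u v w => by
    obtain ⟨L, hL, hLu⟩ := hasFDerivAt_covDerivAlong hG' hF v w
    have h1 := (hdG.clm_apply ((hGp.hasFDerivAt_christoffelMap.clm_apply
      (hasFDerivAt_const v p)).clm_apply (hasFDerivAt_const w p))).clm_apply (hasFDerivAt_const z p)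
    have h2 := ((hdG'.comp p hdF).clm_apply hL).clm_apply (hddF.clm_apply (hasFDerivAt_const z p))
    have h3 := h2.congr_of_eventuallyEq (hev v w z)
    have h4 := DFunLike.congr_fun (h1.unique h3) u
    simp only [ContinuousLinearMap.comp_apply, _root_.add_apply, ContinuousLinearMap.flip_apply,
      _root_.zero_apply, map_zero, zero_add, hLu, hGp.fderiv_apply_eq,
      hG'.fderiv_apply_eq, Function.comp_apply] at h4
    rw [show covDerivAlong G' F p u z = fderiv ℝ (fderiv ℝ F) p u z +
      christoffelMap G' (F p) (fderiv ℝ F p u) (fderiv ℝ F p z) from rfl]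
    simp only [map_add, _root_.add_apply] at h4 ⊢
    linarith
  -- In `∇̄_u ∇̄_v - ∇̄_v ∇̄_u` all terms with second or third derivatives of `F` cancel, by
  -- symmetry or in cross pairs.
  have hvec : coordCurvature G' (F p) (fderiv ℝ F p u) (fderiv ℝ F p v) (fderiv ℝ F p w) =
      (fderiv ℝ (fderiv ℝ (fderiv ℝ F)) p u v w +
        fderiv ℝ (christoffelMap G') (F p) (fderiv ℝ F p u) (fderiv ℝ F p v) (fderiv ℝ F p w) +
        christoffelMap G' (F p) (fderiv ℝ (fderiv ℝ F) p u v) (fderiv ℝ F p w) +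
        christoffelMap G' (F p) (fderiv ℝ F p v) (fderiv ℝ (fderiv ℝ F) p u w) +
        christoffelMap G' (F p) (fderiv ℝ F p u) (covDerivAlong G' F p v w)) -
      (fderiv ℝ (fderiv ℝ (fderiv ℝ F)) p v u w +
        fderiv ℝ (christoffelMap G') (F p) (fderiv ℝ F p v) (fderiv ℝ F p u) (fderiv ℝ F p w) +
        christoffelMap G' (F p) (fderiv ℝ (fderiv ℝ F) p v u) (fderiv ℝ F p w) +
        christoffelMap G' (F p) (fderiv ℝ F p u) (fderiv ℝ (fderiv ℝ F) p v w) +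
        christoffelMap G' (F p) (fderiv ℝ F p v) (covDerivAlong G' F p u w)) := by
    rw [hG'.coordCurvature_eq, covDerivAlong, covDerivAlong, isSymm_fderiv_fderiv hF1 v u,
      isSymm_fderiv_fderiv (hF.of_le (by decide)) v u]
    simp only [map_add]
    abel
  have hc : coordCurvature G p u v w =
      (fderiv ℝ (christoffelMap G) p u v w + christoffelMap G p u (christoffelMap G p v w)) -
      (fderiv ℝ (christoffelMap G) p v u w + christoffelMap G p v (christoffelMap G p u w)) := by
    rw [hGp.coordCurvature_eq]
    abel
  rw [hc, hvec]
  simp only [map_sub (G p), map_sub (G' (F p)), _root_.sub_apply, key]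
  ring

/-- The second fundamental form `∇̄_v (dF w) - dF (∇_v w)` of `F`, for constant fields `v, w`. -/
noncomputable def coordSecondForm (G : E → E →L[ℝ] E →L[ℝ] ℝ) (G' : E' → E' →L[ℝ] E' →L[ℝ] ℝ)
    (F : E → E') (p : E) : E →ₗ[ℝ] E →ₗ[ℝ] E' :=
  LinearMap.mk₂ ℝ
    (fun v w => covDerivAlong G' F p v w - fderiv ℝ F p (christoffelMap G p v w))
    (fun _ _ _ => by simp only [covDerivAlong, map_add, _root_.add_apply]; abel)
    (fun _ _ _ => by simp only [covDerivAlong, map_smul, _root_.smul_apply, smul_sub, smul_add])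
    (fun _ _ _ => by simp only [covDerivAlong, map_add]; abel)
    (fun _ _ _ => by simp only [covDerivAlong, map_smul, smul_sub, smul_add])

omit [FiniteDimensional ℝ E] [FiniteDimensional ℝ E'] in
theorem coordSecondForm_apply (v w : E) : coordSecondForm G G' F p v w =
    covDerivAlong G' F p v w - fderiv ℝ F p (christoffelMap G p v w) := rfl

/-- The Gauss equation. -/
theorem inner_coordCurvature_eq_secondForm (hG' : IsLocalMetric G' (F p))
    (hF : ContDiffAt ℝ 3 F p) (hinj : ∀ᶠ q in 𝓝 p, Function.Injective (fderiv ℝ F q))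
    (hG : ∀ᶠ q in 𝓝 p, ∀ u v, G q u v = G' (F q) (fderiv ℝ F q u) (fderiv ℝ F q v))
    (u v : E) :
    G p (coordCurvature G p u v v) u =
      G' (F p) (coordCurvature G' (F p) (fderiv ℝ F p u) (fderiv ℝ F p v) (fderiv ℝ F p v))
        (fderiv ℝ F p u) +
      (G' (F p) (coordSecondForm G G' F p u u) (coordSecondForm G G' F p v v) -
        G' (F p) (coordSecondForm G G' F p u v) (coordSecondForm G G' F p u v)) := by
  have hGp := isLocalMetric_pullback hG' hF hinj hG
  have hF2 : ContDiffAt ℝ 2 F p := hF.of_le (by decide)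
  have hs := hG'.symm.self_of_nhds
  have hpull := hG.self_of_nhds
  have hSF : ∀ v w z, G' (F p) (covDerivAlong G' F p v w) (fderiv ℝ F p z) =
      G p (christoffelMap G p v w) z := fun v w z =>
    (inner_christoffel_pullback hG' hF2 hGp hG v w z).symm
  -- Pythagoras: the second form is the ambient derivative minus its tangential projection.
  have hh : ∀ a b a' b', G' (F p) (coordSecondForm G G' F p a b) (coordSecondForm G G' F p a' b') =
      G' (F p) (covDerivAlong G' F p a b) (covDerivAlong G' F p a' b') -
      G p (christoffelMap G p a b) (christoffelMap G p a' b') := fun a b a' b' => by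
    simp only [coordSecondForm_apply, map_sub, _root_.sub_apply, hSF, ← hpull,
      hs (fderiv ℝ F p (christoffelMap G p a b)) (covDerivAlong G' F p a' b')]
    rw [hGp.symm.self_of_nhds (christoffelMap G p a' b')]
    ring
  rw [inner_coordCurvature_pullback hG' hF hinj hG, hh, hh, covDerivAlong_symm hG' hF2 v u,
    hGp.christoffel_symm v u, hs _ (covDerivAlong G' F p u u),
    hGp.symm.self_of_nhds (christoffelMap G p v v)]
  ring

end Immersion

end Coordinates

end CRGeom

namespace CRGeom

/-! ### Passage from manifolds to preferred charts. -/

section Manifold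

open Filter Topology

variable {E : Type*} [NormedAddCommGroup E] [NormedSpace ℝ E]
  {M : Type*} [TopologicalSpace M] [ChartedSpace E M]

theorem chartMetric_apply
    (g : ∀ y : M, TangentSpace 𝓘(ℝ, E) y →L[ℝ] TangentSpace 𝓘(ℝ, E) y →L[ℝ] ℝ) (x : M)
    (p u v : E) : chartMetric g x p u v = g ((extChartAt 𝓘(ℝ, E) x).symm p)
      (mfderiv 𝓘(ℝ, E) 𝓘(ℝ, E) (extChartAt 𝓘(ℝ, E) x).symm p u)
      (mfderiv 𝓘(ℝ, E) 𝓘(ℝ, E) (extChartAt 𝓘(ℝ, E) x).symm p v) := rfl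

theorem mfderiv_extChartAt_symm_self [IsManifold 𝓘(ℝ, E) 1 M] (x : M) (u : E) :
    (mfderiv 𝓘(ℝ, E) 𝓘(ℝ, E) (extChartAt 𝓘(ℝ, E) x).symm (extChartAt 𝓘(ℝ, E) x x) : E → E) u = u := by
  have h := mfderivWithin_range_extChartAt_symm (I := 𝓘(ℝ, E)) (x := x)
  rw [modelWithCornersSelf_coe, Set.range_id, mfderivWithin_univ] at h
  rw [h]; rfl

theorem chartMetric_self [IsManifold 𝓘(ℝ, E) 1 M]
    (g : ∀ y : M, TangentSpace 𝓘(ℝ, E) y →L[ℝ] TangentSpace 𝓘(ℝ, E) y →L[ℝ] ℝ) (x : M)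
    (u v : E) : chartMetric g x (extChartAt 𝓘(ℝ, E) x x) u v = g x u v := by
  rw [chartMetric_apply]
  erw [mfderiv_extChartAt_symm_self, mfderiv_extChartAt_symm_self]
  exact congrArg (fun y => (show E →L[ℝ] E →L[ℝ] ℝ from g y) u v) (extChartAt_to_inv x)

theorem mfderiv_extChartAt_symm_injective [IsManifold 𝓘(ℝ, E) 1 M] (x : M) {q : E}
    (hq : q ∈ (extChartAt 𝓘(ℝ, E) x).target) :
    Function.Injective (mfderiv 𝓘(ℝ, E) 𝓘(ℝ, E) (extChartAt 𝓘(ℝ, E) x).symm q) := by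
  have h := (isInvertible_mfderivWithin_extChartAt_symm hq).injective
  rwa [modelWithCornersSelf_coe, Set.range_id, mfderivWithin_univ] at h

/-- A basis identifies `E →L[ℝ] F` with a finite power of `F`. -/
theorem contDiffAt_clm_of_apply {D F : Type*} [NormedAddCommGroup D] [NormedSpace ℝ D]
    [NormedAddCommGroup F] [NormedSpace ℝ F] [FiniteDimensional ℝ E] {n : ℕ∞ω}
    {f : D → E →L[ℝ] F} {p : D} (h : ∀ u, ContDiffAt ℝ n (fun q => f q u) p) :
    ContDiffAt ℝ n f p := by
  let d := Module.finrank ℝ E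
  have hd : d = Module.finrank ℝ (Fin d → ℝ) := (Module.finrank_fin_fun ℝ).symm
  let e₁ := ContinuousLinearEquiv.ofFinrankEq hd
  let e₂ := (e₁.arrowCongr (1 : F ≃L[ℝ] F)).trans (ContinuousLinearEquiv.piRing (Fin d))
  rw [← Function.id_comp f, ← e₂.symm_comp_self]
  exact e₂.symm.contDiff.contDiffAt.comp p (contDiffAt_pi.mpr fun i => h _)

/-- Constant vectors in the trivialization are smooth local sections. Since `symmL` is the
derivative of the inverse chart, these functions are the coefficients of `chartMetric`. -/
theorem contMDiffAt_metric_symmL [IsManifold 𝓘(ℝ, E) ∞ M]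
    (g : Bundle.ContMDiffRiemannianMetric 𝓘(ℝ, E) ∞ E (fun y : M => TangentSpace 𝓘(ℝ, E) y))
    (x : M) (u v : E) : ContMDiffAt 𝓘(ℝ, E) 𝓘(ℝ) 2 (fun y => g.inner y
      ((trivializationAt E (TangentSpace 𝓘(ℝ, E)) x).symmL ℝ y u)
      ((trivializationAt E (TangentSpace 𝓘(ℝ, E)) x).symmL ℝ y v)) x := by
  have : IsManifold 𝓘(ℝ, E) (2 + 1) M := IsManifold.of_le (n := ∞) (by norm_num; decide)
  have hs : ∀ u : E, ContMDiffAt 𝓘(ℝ, E) (𝓘(ℝ, E).prod 𝓘(ℝ, E)) 2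
      (fun y => Bundle.TotalSpace.mk' E (E := fun y : M => TangentSpace 𝓘(ℝ, E) y) y
        ((trivializationAt E (TangentSpace 𝓘(ℝ, E)) x).symmL ℝ y u)) x := fun u => by
    have h1 := (trivializationAt E (TangentSpace 𝓘(ℝ, E) : M → Type _) x).contMDiffAt_symmL
      (n := 2) (IB := 𝓘(ℝ, E)) (FiberBundle.mem_baseSet_trivializationAt' x)
    have h2 : ContMDiffAt 𝓘(ℝ, E) (𝓘(ℝ, E).prod 𝓘(ℝ, E)) 2
        (fun y => Bundle.TotalSpace.mk' E (E := Bundle.Trivial M E) y u) x :=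
      Bundle.contMDiffAt_totalSpace.2 ⟨contMDiffAt_id, contMDiffAt_const⟩
    exact h1.clm_bundle_apply h2
  have hg := (g.contMDiff x).of_le (m := 2) (by decide)
  have h := ContMDiffAt.clm_bundle_apply₂ (E₃ := Bundle.Trivial M ℝ) (F₃ := ℝ) (b := id) hg
    (hs u) (hs v)
  exact (Bundle.contMDiffAt_totalSpace.1 h).2

theorem isLocalMetric_chartMetric [FiniteDimensional ℝ E] [IsManifold 𝓘(ℝ, E) ∞ M]
    (g : Bundle.ContMDiffRiemannianMetric 𝓘(ℝ, E) ∞ E (fun y : M => TangentSpace 𝓘(ℝ, E) y))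
    (x : M) : IsLocalMetric (chartMetric g.inner x) (extChartAt 𝓘(ℝ, E) x x) := by
  have : IsManifold 𝓘(ℝ, E) (2 + 1) M := IsManifold.of_le (n := ∞) (by norm_num; decide)
  have : IsManifold 𝓘(ℝ, E) 1 M := IsManifold.of_le (n := ∞) (by decide)
  have htarget : ∀ᶠ q in 𝓝 (extChartAt 𝓘(ℝ, E) x x), q ∈ (extChartAt 𝓘(ℝ, E) x).target :=
    extChartAt_target_mem_nhds x
  refine ⟨?_, ?_, ?_⟩
  · refine contDiffAt_clm_of_apply fun u => contDiffAt_clm_of_apply fun v => ?_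
    have h := (contMDiffAt_iff.1 (contMDiffAt_metric_symmL g x u v)).2
    simp only [extChartAt_model_space_eq_id, modelWithCornersSelf_coe, Set.range_id,
      contDiffWithinAt_univ] at h
    refine h.congr_of_eventuallyEq ?_
    filter_upwards [htarget] with q hq
    have hsrc : (extChartAt 𝓘(ℝ, E) x).symm q ∈ (chartAt E x).source := by
      simpa using (extChartAt 𝓘(ℝ, E) x).map_target hq
    have hL := TangentBundle.symmL_trivializationAt (I := 𝓘(ℝ, E)) hsrc
    rw [modelWithCornersSelf_coe, Set.range_id, mfderivWithin_univ] at hL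
    have hL' : ∀ u : E, (trivializationAt E (TangentSpace 𝓘(ℝ, E)) x).symmL ℝ
        ((extChartAt 𝓘(ℝ, E) x).symm q) u =
        (mfderiv 𝓘(ℝ, E) 𝓘(ℝ, E) (extChartAt 𝓘(ℝ, E) x).symm q : E → E) u := fun u => by
      rw [hL, (extChartAt 𝓘(ℝ, E) x).right_inv hq]
      rfl
    rw [chartMetric_apply]
    simp only [Function.comp_apply, hL']
    rfl
  · exact Eventually.of_forall fun q u v => g.symm _ _ _
  · filter_upwards [htarget] with q hq u hu
    have hi := (injective_iff_map_eq_zero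
      (mfderiv 𝓘(ℝ, E) 𝓘(ℝ, E) (extChartAt 𝓘(ℝ, E) x).symm q)).1
      (mfderiv_extChartAt_symm_injective x hq) u
    rw [chartMetric_apply]
    exact g.pos _ _ fun h => hu (hi h)

variable {E' : Type*} [NormedAddCommGroup E'] [NormedSpace ℝ E']
  {N : Type*} [TopologicalSpace N] [ChartedSpace E' N] {f : M → N} {x : M}

theorem contDiffAt_writtenInExtChartAt {n : ℕ∞ω} (hf : ContMDiffAt 𝓘(ℝ, E) 𝓘(ℝ, E') n f x) :
    ContDiffAt ℝ n (writtenInExtChartAt 𝓘(ℝ, E) 𝓘(ℝ, E') x f) (extChartAt 𝓘(ℝ, E) x x) := by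
  simpa [contDiffWithinAt_univ] using! (contMDiffAt_iff.1 hf).2

theorem mfderiv_eq_fderiv_writtenInExtChartAt (hf : MDifferentiableAt 𝓘(ℝ, E) 𝓘(ℝ, E') f x) :
    (mfderiv 𝓘(ℝ, E) 𝓘(ℝ, E') f x : E →L[ℝ] E') =
      fderiv ℝ (writtenInExtChartAt 𝓘(ℝ, E) 𝓘(ℝ, E') x f) (extChartAt 𝓘(ℝ, E) x x) := by
  rw [hf.mfderiv, modelWithCornersSelf_coe, Set.range_id, fderivWithin_univ]

theorem eventually_injective_fderiv_writtenInExtChartAt [FiniteDimensional ℝ E]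
    (hf : ContMDiffAt 𝓘(ℝ, E) 𝓘(ℝ, E') ∞ f x)
    (hinj : Function.Injective (mfderiv 𝓘(ℝ, E) 𝓘(ℝ, E') f x)) :
    ∀ᶠ q in 𝓝 (extChartAt 𝓘(ℝ, E) x x),
      Function.Injective (fderiv ℝ (writtenInExtChartAt 𝓘(ℝ, E) 𝓘(ℝ, E') x f) q) := by
  have hc : ContinuousAt (fderiv ℝ (writtenInExtChartAt 𝓘(ℝ, E) 𝓘(ℝ, E') x f))
      (extChartAt 𝓘(ℝ, E) x x) :=
    ((contDiffAt_writtenInExtChartAt hf).fderiv_right (m := 0) (by decide)).continuousAt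
  refine hc.eventually (ContinuousLinearMap.isOpen_injective.mem_nhds ?_)
  have h := mfderiv_eq_fderiv_writtenInExtChartAt (hf.mdifferentiableAt (by decide))
  have h' : Function.Injective (mfderiv 𝓘(ℝ, E) 𝓘(ℝ, E') f x : E →L[ℝ] E') := hinj
  rwa [h] at h'

theorem eventually_comp_extChartAt_symm (hf : ContinuousAt f x) :
    ∀ᶠ q in 𝓝 (extChartAt 𝓘(ℝ, E) x x), f ((extChartAt 𝓘(ℝ, E) x).symm q) ∈
      (extChartAt 𝓘(ℝ, E') (f x)).source := by
  have h : ContinuousAt (f ∘ (extChartAt 𝓘(ℝ, E) x).symm) (extChartAt 𝓘(ℝ, E) x x) :=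
    ContinuousAt.comp (by rwa [extChartAt_to_inv]) (continuousAt_extChartAt_symm x)
  refine h ?_
  simpa [extChartAt_to_inv] using extChartAt_source_mem_nhds (I := 𝓘(ℝ, E')) (f x)

/-- The chain rule applied to `φ'⁻¹ ∘ F = f ∘ φ⁻¹`, valid near the base point, where `φ, φ'` are the
charts and `F` is `f` written in them. -/
theorem mfderiv_symm_fderiv_writtenInExtChartAt [IsManifold 𝓘(ℝ, E) 1 M]
    [IsManifold 𝓘(ℝ, E') 1 N] (hf : ContMDiff 𝓘(ℝ, E) 𝓘(ℝ, E') 1 f) (x : M) :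
    ∀ᶠ q in 𝓝 (extChartAt 𝓘(ℝ, E) x x), ∀ u : E,
      (mfderiv 𝓘(ℝ, E') 𝓘(ℝ, E') (extChartAt 𝓘(ℝ, E') (f x)).symm
        (writtenInExtChartAt 𝓘(ℝ, E) 𝓘(ℝ, E') x f q) : E' →L[ℝ] E')
        (fderiv ℝ (writtenInExtChartAt 𝓘(ℝ, E) 𝓘(ℝ, E') x f) q u) =
      (mfderiv 𝓘(ℝ, E) 𝓘(ℝ, E') f ((extChartAt 𝓘(ℝ, E) x).symm q) : E →L[ℝ] E')
        ((mfderiv 𝓘(ℝ, E) 𝓘(ℝ, E) (extChartAt 𝓘(ℝ, E) x).symm q : E →L[ℝ] E) u) := by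
  have hsmooth := (contDiffAt_writtenInExtChartAt (hf x)).eventually (by decide)
  have hsrc := eventually_comp_extChartAt_symm (E := E) (E' := E') (hf x).continuousAt
  have htarget : ∀ᶠ q in 𝓝 (extChartAt 𝓘(ℝ, E) x x), q ∈ (extChartAt 𝓘(ℝ, E) x).target :=
    extChartAt_target_mem_nhds x
  filter_upwards [hsmooth, hsrc.eventually_nhds, htarget] with q h1 h2 h3 u
  have hev : (extChartAt 𝓘(ℝ, E') (f x)).symm ∘ writtenInExtChartAt 𝓘(ℝ, E) 𝓘(ℝ, E') x f =ᶠ[𝓝 q]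
      f ∘ (extChartAt 𝓘(ℝ, E) x).symm :=
    h2.mono fun q' hq' => (extChartAt 𝓘(ℝ, E') (f x)).left_inv hq'
  have d1 : MDifferentiableAt 𝓘(ℝ, E) 𝓘(ℝ, E) (extChartAt 𝓘(ℝ, E) x).symm q := by
    have := mdifferentiableWithinAt_extChartAt_symm (I := 𝓘(ℝ, E)) h3
    rwa [modelWithCornersSelf_coe, Set.range_id, mdifferentiableWithinAt_univ] at this
  have d2 : MDifferentiableAt 𝓘(ℝ, E') 𝓘(ℝ, E') (extChartAt 𝓘(ℝ, E') (f x)).symm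
      (writtenInExtChartAt 𝓘(ℝ, E) 𝓘(ℝ, E') x f q) := by
    have := mdifferentiableWithinAt_extChartAt_symm (I := 𝓘(ℝ, E'))
      ((extChartAt 𝓘(ℝ, E') (f x)).map_source h2.self_of_nhds)
    rwa [modelWithCornersSelf_coe, Set.range_id, mdifferentiableWithinAt_univ] at this
  have e1 := (((hf _).mdifferentiableAt (by decide)).hasMFDerivAt.comp q d1.hasMFDerivAt).mfderiv
  have e2 := (d2.hasMFDerivAt.comp q
    (h1.differentiableAt (by decide)).mdifferentiableAt.hasMFDerivAt).mfderiv
  have e3 := hev.mfderiv_eq (I := 𝓘(ℝ, E)) (I' := 𝓘(ℝ, E'))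
  have e4 := e2.symm.trans (e3.trans e1)
  rw [mfderiv_eq_fderiv] at e4
  exact DFunLike.congr_fun (F := E →L[ℝ] E') e4 u

theorem chartMetric_inducedMetric [IsManifold 𝓘(ℝ, E) 1 M]
    [IsManifold 𝓘(ℝ, E') 1 N] (hf : ContMDiff 𝓘(ℝ, E) 𝓘(ℝ, E') 1 f)
    (g : ∀ y : N, TangentSpace 𝓘(ℝ, E') y →L[ℝ] TangentSpace 𝓘(ℝ, E') y →L[ℝ] ℝ) (x : M) :
    ∀ᶠ q in 𝓝 (extChartAt 𝓘(ℝ, E) x x), ∀ u v : E,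
      chartMetric (inducedMetric (E := E) g f) x q u v =
        chartMetric g (f x) (writtenInExtChartAt 𝓘(ℝ, E) 𝓘(ℝ, E') x f q)
          (fderiv ℝ (writtenInExtChartAt 𝓘(ℝ, E) 𝓘(ℝ, E') x f) q u)
          (fderiv ℝ (writtenInExtChartAt 𝓘(ℝ, E) 𝓘(ℝ, E') x f) q v) := by
  filter_upwards [mfderiv_symm_fderiv_writtenInExtChartAt hf x,
    eventually_comp_extChartAt_symm (E := E) (E' := E') (hf x).continuousAt] with q h1 h2 u v
  have h3 : (extChartAt 𝓘(ℝ, E') (f x)).symm (writtenInExtChartAt 𝓘(ℝ, E) 𝓘(ℝ, E') x f q) =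
      f ((extChartAt 𝓘(ℝ, E) x).symm q) := (extChartAt 𝓘(ℝ, E') (f x)).left_inv h2
  have h4 := congrArg (fun y => (show E' →L[ℝ] E' →L[ℝ] ℝ from g y)) h3
  rw [chartMetric_apply, chartMetric_apply]
  have h5 := congrArg₂ (fun a b => (show E' →L[ℝ] E' →L[ℝ] ℝ from
    g (f ((extChartAt 𝓘(ℝ, E) x).symm q))) a b) (h1 u) (h1 v)
  refine h5.symm.trans ?_
  exact (DFunLike.congr_fun (F := E' →L[ℝ] ℝ)
    (DFunLike.congr_fun (F := E' →L[ℝ] E' →L[ℝ] ℝ) h4 _) _).symm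

theorem inner_curvature_le_of_orthonormal
    {g : ∀ y : N, TangentSpace 𝓘(ℝ, E') y →L[ℝ] TangentSpace 𝓘(ℝ, E') y →L[ℝ] ℝ} {c : ℝ}
    (hc : SectionalCurvatureLE g c) (y : N) (hs : ∀ u v, g y u v = g y v u)
    {u v : TangentSpace 𝓘(ℝ, E') y} (hu : g y u u = 1) (hv : g y v v = 1) (huv : g y u v = 0) :
    g y (curvature g y u v v) u ≤ c := by
  have hli : LinearIndependent ℝ ![u, v] := by
    refine linearIndependent_of_orthonormal (g := g y) fun i j => ?_
    fin_cases i <;> fin_cases j <;> simp [hu, hv, huv, hs v u]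
  simpa [sectionalCurvature, hu, hv, huv] using hc y u v hli

theorem secondFundamentalForm_eq_coordSecondForm
    (g : ∀ y : N, TangentSpace 𝓘(ℝ, E') y →L[ℝ] TangentSpace 𝓘(ℝ, E') y →L[ℝ] ℝ)
    (f : M → N) (x : M) (u v : E) : secondFundamentalForm (E := E) g f x u v =
      coordSecondForm (chartMetric (inducedMetric (E := E) g f) x) (chartMetric g (f x))
        (writtenInExtChartAt 𝓘(ℝ, E) 𝓘(ℝ, E') x f) (extChartAt 𝓘(ℝ, E) x x) u v := by
  simp only [secondFundamentalForm, coordSecondForm_apply, covDerivAlong, christoffelMap_apply]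
  rfl

/-- At the centre of a preferred chart the chart metric is the metric itself, so the coordinate
Gauss equation supplies `hRc` of `chenDelta_le`. -/
theorem chenDelta_le_of_immersion [FiniteDimensional ℝ E] [FiniteDimensional ℝ E']
    [IsManifold 𝓘(ℝ, E) ∞ M] [IsManifold 𝓘(ℝ, E') ∞ N]
    (g : Bundle.ContMDiffRiemannianMetric 𝓘(ℝ, E') ∞ E' (fun y : N => TangentSpace 𝓘(ℝ, E') y))
    (hf : ContMDiff 𝓘(ℝ, E) 𝓘(ℝ, E') ∞ f) (x : M)
    (hinj : Function.Injective (mfderiv 𝓘(ℝ, E) 𝓘(ℝ, E') f x)) (c : ℝ)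
    (hc : SectionalCurvatureLE g.inner c) (D : Submodule ℝ (TangentSpace 𝓘(ℝ, E) x)) {d : ℕ}
    (hd : Module.finrank ℝ D = d) (hd0 : 0 < d) {k : ℕ} (n : Fin k → ℕ) (hn : ∑ i, n i ≤ d) :
    chenDelta (inducedMetric (E := E) g.inner f x)
      (curvature (inducedMetric (E := E) g.inner f) x) D n ≤
      (d + k - 1 - ∑ i, (n i : ℝ)) / (2 * (d + k - ∑ i, (n i : ℝ))) *
        g.inner (f x) (meanCurvature g.inner f x D) (meanCurvature g.inner f x D) +
      c / 2 * (d * (d - 1) - ∑ i, (n i : ℝ) * (n i - 1)) := by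
  have : IsManifold 𝓘(ℝ, E) 1 M := IsManifold.of_le (n := ∞) (by decide)
  have : IsManifold 𝓘(ℝ, E') 1 N := IsManifold.of_le (n := ∞) (by decide)
  let G : E → E →L[ℝ] E →L[ℝ] ℝ := chartMetric (inducedMetric (E := E) g.inner f) x
  let G' : E' → E' →L[ℝ] E' →L[ℝ] ℝ := chartMetric g.inner (f x)
  let F : E → E' := writtenInExtChartAt 𝓘(ℝ, E) 𝓘(ℝ, E') x f
  let p : E := extChartAt 𝓘(ℝ, E) x x
  have hFp : F p = extChartAt 𝓘(ℝ, E') (f x) (f x) := by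
    simp only [F, p, writtenInExtChartAt, Function.comp_apply, extChartAt_to_inv]
  have hG' : IsLocalMetric G' (F p) := by
    rw [hFp]; exact isLocalMetric_chartMetric g (f x)
  have hF : ContDiffAt ℝ 3 F p := (contDiffAt_writtenInExtChartAt (hf x)).of_le (by decide)
  have hFinj := eventually_injective_fderiv_writtenInExtChartAt (hf x) hinj
  have hG : ∀ᶠ q in 𝓝 p, ∀ u v, G q u v = G' (F q) (fderiv ℝ F q u) (fderiv ℝ F q v) :=
    chartMetric_inducedMetric (hf.of_le (by decide)) g.inner x
  have hGp : IsLocalMetric G p := isLocalMetric_pullback hG' hF hFinj hG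
  -- Tangent spaces are definitionally the model spaces; the retyped copies let the coordinate
  -- results apply.
  let gx : E →L[ℝ] E →L[ℝ] ℝ := inducedMetric (E := E) g.inner f x
  let gy : E' →L[ℝ] E' →L[ℝ] ℝ := g.inner (f x)
  let D' : Submodule ℝ E := D
  have hgG : gx = G p := by
    refine ContinuousLinearMap.ext fun u => ContinuousLinearMap.ext fun v => ?_
    exact (chartMetric_self _ x u v).symm
  have hgG' : gy = G' (F p) := by
    refine ContinuousLinearMap.ext fun u => ContinuousLinearMap.ext fun v => ?_
    rw [hFp]
    exact (chartMetric_self _ (f x) u v).symm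
  have hRc : ∀ u v, G p u u = 1 → G p v v = 1 → G p u v = 0 →
      G p (coordCurvature G p u v v) u ≤ c +
        (G' (F p) (coordSecondForm G G' F p u u) (coordSecondForm G G' F p v v) -
          G' (F p) (coordSecondForm G G' F p u v) (coordSecondForm G G' F p u v)) := by
    intro u v hu hv huv
    rw [inner_coordCurvature_eq_secondForm hG' hF hFinj hG]
    rw [hG.self_of_nhds, ← hgG'] at hu hv huv
    have h := inner_curvature_le_of_orthonormal hc (f x) (g.symm _) hu hv huv
    have h' : G' (F p) (coordCurvature G' (F p) (fderiv ℝ F p u) (fderiv ℝ F p v)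
        (fderiv ℝ F p v)) (fderiv ℝ F p u) ≤ c := by
      rw [← hgG', hFp]; exact h
    linarith
  have main := chenDelta_le (G p) hGp.symm.self_of_nhds hGp.pos.self_of_nhds
    hGp.isTrilinear_coordCurvature (coordCurvature_self G p) (G' (F p)) hG'.symm.self_of_nhds
    (fun u => by
      rcases eq_or_ne u 0 with rfl | hu
      · simp
      · exact (hG'.pos.self_of_nhds u hu).le)
    (coordSecondForm G G' F p) c hRc D' (hd0.trans_eq hd.symm) n (hn.trans_eq hd.symm)
  have hH : meanCurvature g.inner f x D =
      traceOn (G p) D' fun u v => coordSecondForm G G' F p u v := by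
    rw [← hgG]
    exact congrArg (traceOn gx D')
      (funext fun u : E => funext fun v : E =>
        secondFundamentalForm_eq_coordSecondForm g.inner f x u v)
  have hd' : Module.finrank ℝ D' = d := hd
  rw [hd', ← hH, ← hgG, ← hgG'] at main
  exact main

end Manifold

end CRGeom

/-! ### The theorem for CR-submanifolds. -/

theorem mainTheorem2
    {E : Type*} [NormedAddCommGroup E] [NormedSpace ℝ E] [FiniteDimensional ℝ E]
    {M : Type*} [TopologicalSpace M] [ChartedSpace E M] [IsManifold 𝓘(ℝ, E) ∞ M]
    {E' : Type*} [NormedAddCommGroup E'] [NormedSpace ℝ E'] [FiniteDimensional ℝ E']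
    {N : Type*} [TopologicalSpace N] [ChartedSpace E' N] [IsManifold 𝓘(ℝ, E') ∞ N]
    (S : CRGeom.AlmostHermitian E' N) (f : M → N) (d l : ℕ)
    (hf : CRGeom.IsCRSubmanifold (E := E) S f d l)
    (c : ℝ) (hc : CRGeom.SectionalCurvatureLE S.metric.inner c)
    (k : ℕ) (n : Fin k → ℕ) (hn : ∑ i, n i ≤ d) (x : M) :
    let g := CRGeom.inducedMetric (E := E) S.metric.inner f
    let D := CRGeom.complexDistribution (E := E) S f x
    let H := CRGeom.meanCurvature S.metric.inner f x D
    let normSq : TangentSpace 𝓘(ℝ, E') (f x) → ℝ := fun ξ => S.metric.inner (f x) ξ ξ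
    let s : ℝ := ∑ i, (n i : ℝ)
    -- the inequality with the mean curvature vector `H_D = ∑ h(e_i, e_i)`
    CRGeom.chenDelta (g x) (CRGeom.curvature g x) D n
        ≤ (d : ℝ) ^ 2 * (d + k - 1 - s) / (2 * (d + k - s)) * normSq H
          + c / 2 * (d * (d - 1) - ∑ i, (n i : ℝ) * (n i - 1)) ∧
    -- the same inequality with the averaged mean curvature vector `d⁻¹ ∑ h(e_i, e_i)`
    CRGeom.chenDelta (g x) (CRGeom.curvature g x) D n
        ≤ (d : ℝ) ^ 2 * (d + k - 1 - s) / (2 * (d + k - s)) * normSq ((d : ℝ)⁻¹ • H)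
          + c / 2 * (d * (d - 1) - ∑ i, (n i : ℝ) * (n i - 1)) := by
  intro g D H normSq s
  have hmain := CRGeom.chenDelta_le_of_immersion S.metric hf.contMDiff x (hf.immersion x) c hc D
    (hf.finrank_distribution x) hf.d_pos n hn
  have hsd : s ≤ d := by simp only [s]; exact_mod_cast hn
  have hd1 : (1 : ℝ) ≤ d := by exact_mod_cast hf.d_pos
  have hH0 : 0 ≤ normSq H := by
    rcases eq_or_ne H 0 with h | h
    · simp [normSq, h]
    · exact (S.metric.pos _ H h).le
  -- For `k = 0` this is `d ≥ 1`; for `k ≥ 1` it follows from `s ≤ d`.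
  have hnum : 0 ≤ (d : ℝ) + k - 1 - s := by
    rcases Nat.eq_zero_or_pos k with rfl | hk
    · have : s = 0 := by simp [s]
      simp [this, hd1]
    · have : (1 : ℝ) ≤ k := by exact_mod_cast hk
      linarith
  have hcoef : 0 ≤ ((d : ℝ) + k - 1 - s) / (2 * (d + k - s)) := by
    apply div_nonneg hnum
    linarith
  have havg : (d : ℝ) ^ 2 * normSq ((d : ℝ)⁻¹ • H) = normSq H := by
    have h0 : (d : ℝ) ≠ 0 := by positivity
    simp only [normSq, map_smul, _root_.smul_apply, smul_eq_mul]
    field_simp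
  refine ⟨hmain.trans ?_, hmain.trans_eq ?_⟩
  -- The coefficient and `|H|²` are nonnegative, so inserting `d² ≥ 1` only enlarges the bound.
  · have h1 : (1 : ℝ) ≤ (d : ℝ) ^ 2 := one_le_pow₀ hd1
    have h2 := mul_le_mul_of_nonneg_right h1 (mul_nonneg hcoef hH0)
    rw [one_mul, ← mul_assoc, ← mul_div_assoc] at h2
    exact add_le_add h2 le_rfl
  · congr 1
    change (d + k - 1 - s) / (2 * (d + k - s)) * normSq H = _
    rw [← havg]
    ring
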